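/- Let $R$ be an associative ring with identity; "$R$-module" means left $R$-module and all modules are unitary. A left $R$-module $N$ is super finitely presented if there is an exact sequence $\cdots\to F_1\to F_0\to N\to 0$ with every $F_i$ finitely generated projective. A left module $X$ is weak injective if $\operatorname{Ext}^1_R(N,X)=0$, and a right module $X$ is weak flat if $\operatorname{Tor}_1^R(X,N)=0$, for every super finitely presented left module $N$. Write $\mathcal{WI}$ and $\mathcal{WF}$ for these classes. A short exact sequence of left (right) modules is pure exact if it remains exact after $Q\otimes_R-$ for every right module $Q$ (after $-\otimes_R Q$ for every left module $Q$). A module $X$ is pure projective (pure injective) if $\operatorname{Hom}_R(X,-)$ (respectively $\operatorname{Hom}_R(-,X)$) is exact on all pure exact sequences. For a class $\mathcal C$ of modules, a left $\mathcal C$-resolution of $X$ is a complex $\cdots\to W_1\to W_0\to X\to 0$ with all $W_i\in\mathcal C$ which becomes exact under $\operatorname{Hom}_R(V,-)$ for all $V\in\mathcal C$. A right $\mathcal C$-resolution of $X$ is a complex $0\to X\to W^0\to W^1\to\cdots$ with all $W^i\in\mathcal C$ which becomes exact under $\operatorname{Hom}_R(-,V)$ for all $V\in\mathcal C$. Every right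 module has a left and a right $\mathcal{WF}$-resolution, and every left module has a right $\mathcal{WI}$-resolution. For right modules $X,Y$ let $$\operatorname{Ext}^{\mathcal{WF}}_0(X,Y)=\operatorname{Hom}_R(X,W_0)/\operatorname{Im}\bigl(\operatorname{Hom}_R(X,W_1)\to\operatorname{Hom}_R(X,W_0)\bigr)$$ for a left $\mathcal{WF}$-resolution $W_\bullet\to Y$, or $$\operatorname{Ext}^{\mathcal{WF}}_0(X,Y)=\operatorname{Hom}_R(W^0,Y)/\operatorname{Im}\bigl(\operatorname{Hom}_R(W^1,Y)\to\operatorname{Hom}_R(W^0,Y)\bigr)$$ for a right $\mathcal{WF}$-resolution $X\to W^\bullet$, and let $\theta:\operatorname{Ext}^{\mathcal{WF}}_0(X,Y)\to\operatorname{Hom}_R(X,Y)$ be induced by $W_0\to Y$, respectively by $X\to W^0$. For a right module $X$ and a left module $L$ let $\operatorname{Tor}^0_{\mathcal W}(X,L)$ be $\operatorname{Ker}(W^0\otimes_R L\to W^1\otimes_R L)$ for a right $\mathcal{WF}$-resolution $X\to W^\bullet$, or $\operatorname{Ker}(X\otimes_R W^0\to X\otimes_R W^1)$ for a right $\mathcal{WI}$-resolution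 $L\to W^\bullet$, and let $\vartheta:X\otimes_R L\to\operatorname{Tor}^0_{\mathcal W}(X,L)$ be the induced map. Then, for all choices of resolutions, and whichever of the two variables is resolved, the following are equivalent for a right $R$-module $M$: 1. $M$ is weak flat; 2. $\theta:\operatorname{Ext}^{\mathcal{WF}}_0(L,M)\to\operatorname{Hom}_R(L,M)$ is surjective for every right $R$-module $L$; 3. $\theta:\operatorname{Ext}^{\mathcal{WF}}_0(L,M)\to\operatorname{Hom}_R(L,M)$ is surjective for every pure projective right $R$-module $L$; 4. $\theta:\operatorname{Ext}^{\mathcal{WF}}_0(M,N)\to\operatorname{Hom}_R(M,N)$ is surjective for every right $R$-module $N$; 5. $\theta:\operatorname{Ext}^{\mathcal{WF}}_0(M,N)\to\operatorname{Hom}_R(M,N)$ is surjective for every pure injective right $R$-module $N$; 6. $\theta:\operatorname{Ext}^{\mathcal{WF}}_0(M,M)\to\operatorname{Hom}_R(M,M)$ is surjective; 7. $\vartheta:M\otimes_R L\to\operatorname{Tor}^0_{\mathcal W}(M,L)$ is injective for every left $R$-module $L$; 8. $\vartheta:M\otimes_R L\to\operatorname{Tor}^0_{\mathcal W}(M,L)$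 is injective for every pure projective left $R$-module $L$. -/

import Mathlib

open CategoryTheory MulOpposite
open scoped TensorProduct

universe u

/- Throughout, `R` is an associative ring with identity, left `R`-modules are objects of
`ModuleCat R`, and right `R`-modules are objects of `ModuleCat Rᵐᵒᵖ` (the element `m r` is
`op r • m`). -/

namespace WeakHomological

section Tensor

variable (R : Type u) [Ring R]

section

variable (M L : Type u) [AddCommGroup M] [Module Rᵐᵒᵖ M] [AddCommGroup L] [Module R L]

/-- The relations `(m r) ⊗ l = m ⊗ (r l)`. -/
def balancing : AddSubgroup (M ⊗[ℤ] L) :=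
  AddSubgroup.closure
    {x | ∃ (m : M) (r : R) (l : L), x = (op r • m) ⊗ₜ[ℤ] l - m ⊗ₜ[ℤ] (r • l)}

/-- The tensor product `M ⊗_R L` of a right module and a left module over an arbitrary ring:
an abelian group. -/
abbrev RingTensor : Type u := (M ⊗[ℤ] L) ⧸ balancing R M L

end

variable {M M' M'' L L' L'' : Type u}
  [AddCommGroup M] [Module Rᵐᵒᵖ M] [AddCommGroup L] [Module R L]
  [AddCommGroup M'] [Module Rᵐᵒᵖ M'] [AddCommGroup L'] [Module R L']
  [AddCommGroup M''] [Module Rᵐᵒᵖ M''] [AddCommGroup L''] [Module R L'']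

/-- The class of `m ⊗ l` in `M ⊗_R L`. -/
def RingTensor.tmul (m : M) (l : L) : RingTensor R M L :=
  QuotientAddGroup.mk (m ⊗ₜ[ℤ] l)

theorem RingTensor.map_aux (f : M →ₗ[Rᵐᵒᵖ] M') (g : L →ₗ[R] L') :
    balancing R M L ≤ (balancing R M' L').comap
      (TensorProduct.map f.toAddMonoidHom.toIntLinearMap
        g.toAddMonoidHom.toIntLinearMap).toAddMonoidHom := by
  refine (AddSubgroup.closure_le _).2 ?_
  rintro x ⟨m, r, l, rfl⟩
  refine AddSubgroup.subset_closure ⟨f m, r, g l, ?_⟩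
  simp [TensorProduct.map_tmul]

/-- The map `f ⊗ g : M ⊗_R L → M' ⊗_R L'`. -/
def RingTensor.map (f : M →ₗ[Rᵐᵒᵖ] M') (g : L →ₗ[R] L') :
    RingTensor R M L →+ RingTensor R M' L' :=
  QuotientAddGroup.map _ _ _ (RingTensor.map_aux R f g)

@[simp]
theorem RingTensor.map_tmul (f : M →ₗ[Rᵐᵒᵖ] M') (g : L →ₗ[R] L') (m : M) (l : L) :
    RingTensor.map R f g (RingTensor.tmul R m l) = RingTensor.tmul R (f m) (g l) := rfl

theorem RingTensor.hom_ext {A : Type*} [AddCommGroup A] {p q : RingTensor R M L →+ A}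
    (h : ∀ m l, p (RingTensor.tmul R m l) = q (RingTensor.tmul R m l)) : p = q := by
  refine QuotientAddGroup.addMonoidHom_ext _ ?_
  ext x
  induction x using TensorProduct.induction_on with
  | zero => simp
  | tmul m l => exact h m l
  | add x y hx hy => rw [map_add, map_add, hx, hy]

theorem RingTensor.map_id :
    RingTensor.map R (LinearMap.id : M →ₗ[Rᵐᵒᵖ] M) (LinearMap.id : L →ₗ[R] L) =
      AddMonoidHom.id _ :=
  RingTensor.hom_ext R fun _ _ => rfl

theorem RingTensor.map_comp (f : M →ₗ[Rᵐᵒᵖ] M') (f' : M' →ₗ[Rᵐᵒᵖ] M'')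
    (g : L →ₗ[R] L') (g' : L' →ₗ[R] L'') :
    RingTensor.map R (f' ∘ₗ f) (g' ∘ₗ g) =
      (RingTensor.map R f' g').comp (RingTensor.map R f g) :=
  RingTensor.hom_ext R fun _ _ => rfl

theorem RingTensor.map_add_right (f : M →ₗ[Rᵐᵒᵖ] M') (g g' : L →ₗ[R] L') :
    RingTensor.map R f (g + g') = RingTensor.map R f g + RingTensor.map R f g' := by
  refine RingTensor.hom_ext R fun m l => ?_
  exact congrArg QuotientAddGroup.mk (TensorProduct.tmul_add (R := ℤ) (f m) (g l) (g' l))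

end Tensor

section Classes

variable {R : Type u} [Ring R]

/-- The functor `M ⊗_R -` from left `R`-modules to abelian groups. -/
def tensorLeft (M : ModuleCat.{u} Rᵐᵒᵖ) : ModuleCat.{u} R ⥤ AddCommGrpCat.{u} where
  obj L := AddCommGrpCat.of (RingTensor R M L)
  map g := AddCommGrpCat.ofHom (RingTensor.map R LinearMap.id g.hom)
  map_id L := by
    ext1
    exact RingTensor.map_id R
  map_comp g g' := by
    ext1
    exact RingTensor.map_comp R LinearMap.id LinearMap.id g.hom g'.hom

instance (M : ModuleCat.{u} Rᵐᵒᵖ) : (tensorLeft M).Additive where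
  map_add {_ _ g g'} := by
    ext1
    exact RingTensor.map_add_right R LinearMap.id g.hom g'.hom

/-- `Tor_n^R(M, N)` for a right module `M` and a left module `N`: the `n`-th left derived functor
of `M ⊗_R -` at `N`. -/
noncomputable def Tor (n : ℕ) (M : ModuleCat.{u} Rᵐᵒᵖ) (N : ModuleCat.{u} R) : AddCommGrpCat.{u} :=
  ((tensorLeft M).leftDerived n).obj N

/-- `N` has a resolution by finitely generated projective modules. -/
def SuperFinitelyPresented (N : ModuleCat.{u} R) : Prop :=
  ∃ P : ProjectiveResolution N, ∀ n, Module.Finite R (P.complex.X n)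

variable (R) in
/-- The class of weak flat right `R`-modules. -/
def weakFlat : ObjectProperty (ModuleCat.{u} Rᵐᵒᵖ) := fun M =>
  ∀ N : ModuleCat.{u} R, SuperFinitelyPresented N → Limits.IsZero (Tor 1 M N)

variable (R) in
/-- The class of weak injective left `R`-modules. -/
def weakInjective : ObjectProperty (ModuleCat.{u} R) := fun M =>
  ∀ N : ModuleCat.{u} R, SuperFinitelyPresented N → Subsingleton (Abelian.Ext N M 1)

/-- The sequence of abelian groups `0 → A → B → C → 0` is exact. -/
def ShortExactMaps {A B C : Type u} [AddCommGroup A] [AddCommGroup B] [AddCommGroup C]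
    (f : A →+ B) (g : B →+ C) : Prop :=
  Function.Injective f ∧ Function.Exact f g ∧ Function.Surjective g

/-- `0 → A → B → C → 0` is a pure exact sequence of left `R`-modules. -/
def PureExactLeft {A B C : ModuleCat.{u} R} (f : A ⟶ B) (g : B ⟶ C) : Prop :=
  ShortExactMaps f.hom.toAddMonoidHom g.hom.toAddMonoidHom ∧
    ∀ Q : ModuleCat.{u} Rᵐᵒᵖ,
      ShortExactMaps (RingTensor.map R (LinearMap.id : Q →ₗ[Rᵐᵒᵖ] Q) f.hom)
        (RingTensor.map R (LinearMap.id : Q →ₗ[Rᵐᵒᵖ] Q) g.hom)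

/-- `0 → A → B → C → 0` is a pure exact sequence of right `R`-modules. -/
def PureExactRight {A B C : ModuleCat.{u} Rᵐᵒᵖ} (f : A ⟶ B) (g : B ⟶ C) : Prop :=
  ShortExactMaps f.hom.toAddMonoidHom g.hom.toAddMonoidHom ∧
    ∀ Q : ModuleCat.{u} R,
      ShortExactMaps (RingTensor.map R f.hom (LinearMap.id : Q →ₗ[R] Q))
        (RingTensor.map R g.hom (LinearMap.id : Q →ₗ[R] Q))

/-- A left module `P` such that `Hom(P, -)` is exact on pure exact sequences. -/
def PureProjectiveLeft (P : ModuleCat.{u} R) : Prop :=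
  ∀ ⦃A B C : ModuleCat.{u} R⦄ (f : A ⟶ B) (g : B ⟶ C), PureExactLeft f g →
    ShortExactMaps (Preadditive.rightComp P f) (Preadditive.rightComp P g)

/-- A right module `P` such that `Hom(P, -)` is exact on pure exact sequences. -/
def PureProjectiveRight (P : ModuleCat.{u} Rᵐᵒᵖ) : Prop :=
  ∀ ⦃A B C : ModuleCat.{u} Rᵐᵒᵖ⦄ (f : A ⟶ B) (g : B ⟶ C), PureExactRight f g →
    ShortExactMaps (Preadditive.rightComp P f) (Preadditive.rightComp P g)

/-- A right module `N` such that `Hom(-, N)` is exact on pure exact sequences. -/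
def PureInjectiveRight (N : ModuleCat.{u} Rᵐᵒᵖ) : Prop :=
  ∀ ⦃A B C : ModuleCat.{u} Rᵐᵒᵖ⦄ (f : A ⟶ B) (g : B ⟶ C), PureExactRight f g →
    ShortExactMaps (Preadditive.leftComp N g) (Preadditive.leftComp N f)

end Classes

section Resolutions

variable {S : Type u} [Ring S]

/-- A left `𝒞`-resolution of `M`: a complex `⋯ → W₁ → W₀ → M → 0` with all `Wᵢ` in `𝒞` that becomes
exact under `Hom(V, -)` for every `V` in `𝒞`. -/
structure LeftResolution (𝒞 : ObjectProperty (ModuleCat.{u} S)) (M : ModuleCat.{u} S) where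
  W : ℕ → ModuleCat.{u} S
  mem : ∀ n, 𝒞 (W n)
  d : ∀ n, W (n + 1) ⟶ W n
  ε : W 0 ⟶ M
  d_comp_d : ∀ n, d (n + 1) ≫ d n = 0
  d_comp_ε : d 0 ≫ ε = 0
  surjective : ∀ V, 𝒞 V → Function.Surjective (Preadditive.rightComp V ε)
  exact_zero : ∀ V, 𝒞 V →
    Function.Exact (Preadditive.rightComp V (d 0)) (Preadditive.rightComp V ε)
  exact_succ : ∀ V, 𝒞 V → ∀ n,
    Function.Exact (Preadditive.rightComp V (d (n + 1))) (Preadditive.rightComp V (d n))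

/-- A right `𝒞`-resolution of `M`: a complex `0 → M → W⁰ → W¹ → ⋯` with all `Wⁱ` in `𝒞` that becomes
exact under `Hom(-, V)` for every `V` in `𝒞`. -/
structure RightResolution (𝒞 : ObjectProperty (ModuleCat.{u} S)) (M : ModuleCat.{u} S) where
  W : ℕ → ModuleCat.{u} S
  mem : ∀ n, 𝒞 (W n)
  d : ∀ n, W n ⟶ W (n + 1)
  η : M ⟶ W 0
  d_comp_d : ∀ n, d n ≫ d (n + 1) = 0
  η_comp_d : η ≫ d 0 = 0
  surjective : ∀ V, 𝒞 V → Function.Surjective (Preadditive.leftComp V η)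
  exact_zero : ∀ V, 𝒞 V →
    Function.Exact (Preadditive.leftComp V (d 0)) (Preadditive.leftComp V η)
  exact_succ : ∀ V, 𝒞 V → ∀ n,
    Function.Exact (Preadditive.leftComp V (d (n + 1))) (Preadditive.leftComp V (d n))

variable {𝒞 : ObjectProperty (ModuleCat.{u} S)}

/-- `Ext^𝒞₀(L, M) = H₀(Hom(L, W_•))`, computed from a left `𝒞`-resolution of `M`. -/
abbrev LeftResolution.Ext₀ {M : ModuleCat.{u} S} (P : LeftResolution 𝒞 M) (L : ModuleCat.{u} S) :
    Type u :=
  (L ⟶ P.W 0) ⧸ (Preadditive.rightComp L (P.d 0)).range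

/-- The canonical map `θ : Ext^𝒞₀(L, M) → Hom(L, M)`, induced by `W₀ → M`. -/
def LeftResolution.θ {M : ModuleCat.{u} S} (P : LeftResolution 𝒞 M) (L : ModuleCat.{u} S) :
    P.Ext₀ L →+ (L ⟶ M) :=
  QuotientAddGroup.lift _ (Preadditive.rightComp L P.ε) <| by
    rintro _ ⟨h, rfl⟩
    change (h ≫ P.d 0) ≫ P.ε = 0
    rw [Category.assoc, P.d_comp_ε, Limits.comp_zero]

/-- `Ext^𝒞₀(M, N) = H₀(Hom(W^•, N))`, computed from a right `𝒞`-resolution of `M`. -/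
abbrev RightResolution.Ext₀ {M : ModuleCat.{u} S} (Q : RightResolution 𝒞 M)
    (N : ModuleCat.{u} S) : Type u :=
  (Q.W 0 ⟶ N) ⧸ (Preadditive.leftComp N (Q.d 0)).range

/-- The canonical map `θ : Ext^𝒞₀(M, N) → Hom(M, N)`, induced by `M → W⁰`. -/
def RightResolution.θ {M : ModuleCat.{u} S} (Q : RightResolution 𝒞 M) (N : ModuleCat.{u} S) :
    Q.Ext₀ N →+ (M ⟶ N) :=
  QuotientAddGroup.lift _ (Preadditive.leftComp N Q.η) <| by
    rintro _ ⟨h, rfl⟩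
    change Q.η ≫ (Q.d 0 ≫ h) = 0
    rw [← Category.assoc, Q.η_comp_d, Limits.zero_comp]

end Resolutions

section WeakTor

variable {R : Type u} [Ring R]

/-- `Tor_𝒲⁰(M, L) = H⁰(W^• ⊗_R L)`, computed from a right weak flat resolution of `M`. -/
abbrev torOfWeakFlat {M : ModuleCat.{u} Rᵐᵒᵖ} (Q : RightResolution (weakFlat R) M)
    (L : ModuleCat.{u} R) : Type u :=
  (RingTensor.map R (Q.d 0).hom (LinearMap.id : L →ₗ[R] L)).ker

/-- The canonical map `ϑ : M ⊗_R L → Tor_𝒲⁰(M, L)`, induced by `M → W⁰`. -/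
def ϑOfWeakFlat {M : ModuleCat.{u} Rᵐᵒᵖ} (Q : RightResolution (weakFlat R) M)
    (L : ModuleCat.{u} R) : RingTensor R M L →+ torOfWeakFlat Q L :=
  (RingTensor.map R Q.η.hom (LinearMap.id : L →ₗ[R] L)).codRestrict _ <| by
    have h : (RingTensor.map R (Q.d 0).hom (LinearMap.id : L →ₗ[R] L)).comp
        (RingTensor.map R Q.η.hom (LinearMap.id : L →ₗ[R] L)) = 0 := by
      refine RingTensor.hom_ext R fun m l => ?_
      have hm : (Q.d 0).hom (Q.η.hom m) = 0 := congrArg (fun k => k.hom m) Q.η_comp_d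
      change RingTensor.tmul R ((Q.d 0).hom (Q.η.hom m)) l = 0
      rw [hm]
      exact congrArg QuotientAddGroup.mk (TensorProduct.zero_tmul (R := ℤ) _ l)
    exact fun x => DFunLike.congr_fun h x

/-- `Tor_𝒲⁰(M, L) = H⁰(M ⊗_R W^•)`, computed from a right weak injective resolution of `L`. -/
abbrev torOfWeakInjective (M : ModuleCat.{u} Rᵐᵒᵖ) {L : ModuleCat.{u} R}
    (J : RightResolution (weakInjective R) L) : Type u :=
  (RingTensor.map R (LinearMap.id : M →ₗ[Rᵐᵒᵖ] M) (J.d 0).hom).ker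

/-- The canonical map `ϑ : M ⊗_R L → Tor_𝒲⁰(M, L)`, induced by `L → W⁰`. -/
def ϑOfWeakInjective (M : ModuleCat.{u} Rᵐᵒᵖ) {L : ModuleCat.{u} R}
    (J : RightResolution (weakInjective R) L) : RingTensor R M L →+ torOfWeakInjective M J :=
  (RingTensor.map R (LinearMap.id : M →ₗ[Rᵐᵒᵖ] M) J.η.hom).codRestrict _ <| by
    have h : (RingTensor.map R (LinearMap.id : M →ₗ[Rᵐᵒᵖ] M) (J.d 0).hom).comp
        (RingTensor.map R (LinearMap.id : M →ₗ[Rᵐᵒᵖ] M) J.η.hom) = 0 := by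
      refine RingTensor.hom_ext R fun m l => ?_
      have hl : (J.d 0).hom (J.η.hom l) = 0 := congrArg (fun k => k.hom l) J.η_comp_d
      change RingTensor.tmul R m ((J.d 0).hom (J.η.hom l)) = 0
      rw [hl]
      exact congrArg QuotientAddGroup.mk (TensorProduct.tmul_zero (R := ℤ) _ m)
    exact fun x => DFunLike.congr_fun h x

end WeakTor

end WeakHomological

/-! Weak flatness is a finitary condition. For a resolution `P` by finitely generated projectives,
the first syzygy K = P₁/im P₂ is finitely presented, and Tor₁(M, N) vanishes exactly when M ⊗ K → M
⊗ P₀ is injective. An element of the kernel involves finitely many elements of M and finitely many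
relations between them, so it can be tested on finitely presented modules mapping to M
(`weakFlat_of_factors`). Likewise M inherits weak flatness from W along any map that stays injective
after tensoring with finitely presented modules (`weakFlat_of_map_injective`).

Surjectivity of θ says that homomorphisms factor through the first weak flat module of the
resolution; injectivity of ϑ says that the first map of the resolution stays injective after
tensoring. If M is weak flat, the factorizations come from the resolution property itself or from
lifting or extending the identity of M. Conversely, finitely presented modules are pure projective,
M⁺⁺ is pure injective with M → M⁺⁺ pure, and a factorization of the identity makes M a retract. When
L is resolved by weak injectives, M⁺ is weak injective if M is weak flat, so characters of M ⊗ L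
extend along L → W⁰; conversely L = K suffices, since K → W⁰ extends to P₀.

Existence of resolutions reduces to preenvelopes and precovers. Both classes are closed under
products and pure submodules, and small subsets lie in small pure submodules, which bounds the
targets needed for a preenvelope. For weak flat precovers the small object argument is run on
inclusions K ⊂ F into one large free module with F/K weak flat. The resulting module is weak flat
because the maps P₀⁺ → K⁺ of syzygies lift against these inclusions, and it is a precover because
any weak flat module is exhausted by pure submodules with small weak flat steps. -/

namespace WeakHomological

/-! ### Tensor products over a noncommutative ring: right exactness and contractions. -/

namespace RingTensor

variable {R : Type u} [Ring R]
variable {M M' M'' L L' L'' : Type u}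
  [AddCommGroup M] [Module Rᵐᵒᵖ M] [AddCommGroup L] [Module R L]
  [AddCommGroup M'] [Module Rᵐᵒᵖ M'] [AddCommGroup L'] [Module R L']
  [AddCommGroup M''] [Module Rᵐᵒᵖ M''] [AddCommGroup L''] [Module R L'']

theorem tmul_add (m : M) (l l' : L) : tmul R m (l + l') = tmul R m l + tmul R m l' :=
  congrArg QuotientAddGroup.mk (TensorProduct.tmul_add (R := ℤ) m l l')

theorem add_tmul (m m' : M) (l : L) : tmul R (m + m') l = tmul R m l + tmul R m' l :=
  congrArg QuotientAddGroup.mk (TensorProduct.add_tmul (R := ℤ) m m' l)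

theorem smul_tmul (r : R) (m : M) (l : L) : tmul R (op r • m) l = tmul R m (r • l) := by
  rw [← sub_eq_zero]
  exact (QuotientAddGroup.eq_zero_iff _).2 (AddSubgroup.subset_closure ⟨m, r, l, rfl⟩)

variable (R) in
/-- `tmul` as a biadditive map. -/
def tmulHom : M →+ L →+ RingTensor R M L :=
  AddMonoidHom.mk' (fun m => AddMonoidHom.mk' (tmul R m) (tmul_add m)) fun m m' => by
    ext l
    exact add_tmul m m' l

theorem zero_tmul (l : L) : tmul R (0 : M) l = 0 :=
  DFunLike.congr_fun (map_zero (tmulHom R (M := M) (L := L))) l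

theorem tmul_zero (m : M) : tmul R m (0 : L) = 0 := map_zero (tmulHom R m)

theorem sub_tmul (m m' : M) (l : L) : tmul R (m - m') l = tmul R m l - tmul R m' l :=
  DFunLike.congr_fun (map_sub (tmulHom R (M := M) (L := L)) m m') l

theorem tmul_sub (m : M) (l l' : L) : tmul R m (l - l') = tmul R m l - tmul R m l' :=
  map_sub (tmulHom R m) l l'

theorem sum_tmul {ι : Type*} (s : Finset ι) (m : ι → M) (l : L) :
    tmul R (∑ i ∈ s, m i) l = ∑ i ∈ s, tmul R (m i) l := by
  change tmulHom R _ l = _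
  rw [map_sum, AddMonoidHom.finsetSum_apply]
  rfl

theorem tmul_sum {ι : Type*} (s : Finset ι) (m : M) (l : ι → L) :
    tmul R m (∑ i ∈ s, l i) = ∑ i ∈ s, tmul R m (l i) :=
  map_sum (tmulHom R m) l s

@[elab_as_elim]
theorem induction_on {p : RingTensor R M L → Prop} (x : RingTensor R M L) (zero : p 0)
    (tmul : ∀ m l, p (tmul R m l)) (add : ∀ x y, p x → p y → p (x + y)) : p x := by
  induction x using QuotientAddGroup.induction_on with
  | H z =>
    induction z using TensorProduct.induction_on with
    | zero => exact zero
    | tmul m l => exact tmul m l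
    | add x y hx hy => exact add _ _ hx hy

theorem exists_sum (x : RingTensor R M L) :
    ∃ (n : ℕ) (m : Fin n → M) (l : Fin n → L), x = ∑ i, tmul R (m i) (l i) := by
  induction x using induction_on with
  | zero => exact ⟨0, Fin.elim0, Fin.elim0, rfl⟩
  | tmul m l => exact ⟨1, fun _ => m, fun _ => l, by simp⟩
  | add x y hx hy =>
    obtain ⟨a, m, l, rfl⟩ := hx
    obtain ⟨b, m', l', rfl⟩ := hy
    exact ⟨a + b, Fin.append m m', Fin.append l l', by simp [Fin.sum_univ_add]⟩

section Lift

variable {A : Type*} [AddCommGroup A]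

/-- The universal property of the tensor product. -/
def lift (f : M → L → A) (hl : ∀ m m' l, f (m + m') l = f m l + f m' l)
    (hr : ∀ m l l', f m (l + l') = f m l + f m l')
    (hb : ∀ m (r : R) l, f (op r • m) l = f m (r • l)) : RingTensor R M L →+ A :=
  QuotientAddGroup.lift _
    (TensorProduct.liftAddHom
      (AddMonoidHom.mk' (fun m => AddMonoidHom.mk' (f m) (hr m)) fun m m' => by
        ext l
        exact hl m m' l)
      (fun z m l => by simp [map_zsmul])) <| by
    rw [balancing, AddSubgroup.closure_le]
    rintro _ ⟨m, r, l, rfl⟩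
    rw [SetLike.mem_coe, AddMonoidHom.mem_ker, map_sub, sub_eq_zero]
    exact hb m r l

end Lift

theorem map_comp_apply (f : M →ₗ[Rᵐᵒᵖ] M') (f' : M' →ₗ[Rᵐᵒᵖ] M'')
    (g : L →ₗ[R] L') (g' : L' →ₗ[R] L'') (x : RingTensor R M L) :
    map R f' g' (map R f g x) = map R (f' ∘ₗ f) (g' ∘ₗ g) x := by
  rw [map_comp]
  rfl

theorem map_id_apply (x : RingTensor R M L) :
    map R (LinearMap.id : M →ₗ[Rᵐᵒᵖ] M) (LinearMap.id : L →ₗ[R] L) x = x := by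
  rw [map_id]
  rfl

theorem map_zero_right (f : M →ₗ[Rᵐᵒᵖ] M') (x : RingTensor R M L) :
    map R f (0 : L →ₗ[R] L') x = 0 := by
  have : map R f (0 : L →ₗ[R] L') = 0 := hom_ext R fun m l => tmul_zero _
  rw [this]; rfl

theorem map_zero_left (g : L →ₗ[R] L') (x : RingTensor R M L) :
    map R (0 : M →ₗ[Rᵐᵒᵖ] M') g x = 0 := by
  have : map R (0 : M →ₗ[Rᵐᵒᵖ] M') g = 0 := hom_ext R fun m l => zero_tmul _
  rw [this]; rfl

theorem map_swap (f : M →ₗ[Rᵐᵒᵖ] M') (g : L →ₗ[R] L') (x : RingTensor R M L) :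
    map R LinearMap.id g (map R f LinearMap.id x) = map R f LinearMap.id (map R LinearMap.id g x) := by
  rw [map_comp_apply, map_comp_apply]
  rfl

theorem map_surjective {f : M →ₗ[Rᵐᵒᵖ] M'} {g : L →ₗ[R] L'} (hf : Function.Surjective f)
    (hg : Function.Surjective g) : Function.Surjective (map R f g) := by
  intro x
  induction x using induction_on with
  | zero => exact ⟨0, map_zero _⟩
  | tmul m l =>
    obtain ⟨m, rfl⟩ := hf m
    obtain ⟨l, rfl⟩ := hg l
    exact ⟨tmul R m l, rfl⟩
  | add x y hx hy =>
    obtain ⟨x, rfl⟩ := hx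
    obtain ⟨y, rfl⟩ := hy
    exact ⟨x + y, map_add _ _ _⟩

/-- Right exactness of `M ⊗_R -`. -/
theorem exact_map_right (M : Type u) [AddCommGroup M] [Module Rᵐᵒᵖ M]
    {f : L →ₗ[R] L'} {g : L' →ₗ[R] L''} (h : Function.Exact f g) (hg : Function.Surjective g) :
    Function.Exact (map R (LinearMap.id : M →ₗ[Rᵐᵒᵖ] M) f) (map R LinearMap.id g) := by
  have key : ∀ (m : M) (l : L'), g l = 0 →
      (tmul R m l : RingTensor R M L') ∈ (map R (LinearMap.id : M →ₗ[Rᵐᵒᵖ] M) f).range := by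
    intro m l hl
    obtain ⟨a, rfl⟩ := (h l).1 hl
    exact ⟨tmul R m a, rfl⟩
  let s := Function.surjInv hg
  have hs : ∀ c, g (s c) = c := Function.surjInv_eq hg
  let Q := RingTensor R M L' ⧸ (map R (LinearMap.id : M →ₗ[Rᵐᵒᵖ] M) f).range
  have aux : ∀ (m : M) (l l' : L'), g l = g l' →
      (QuotientAddGroup.mk (tmul R m l) : Q) = QuotientAddGroup.mk (tmul R m l') := by
    intro m l l' e
    rw [← sub_eq_zero, ← QuotientAddGroup.mk_sub, QuotientAddGroup.eq_zero_iff, ← tmul_sub]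
    exact key m _ (by rw [map_sub, e, sub_self])
  -- The section `s` is only set-theoretic, but two lifts of `c` differ by an element of im f, so
  -- modulo the range of M ⊗ f the choice is invisible. The map recovers the class of x from its
  -- image under M ⊗ g.
  let inv : RingTensor R M L'' →+ Q := lift (fun m c => QuotientAddGroup.mk (tmul R m (s c)))
    (fun m m' l => by rw [add_tmul, QuotientAddGroup.mk_add])
    (fun m l l' => by
      rw [← QuotientAddGroup.mk_add, ← tmul_add]
      exact aux _ _ _ (by simp [hs]))
    (fun m r l => by
      rw [smul_tmul]
      exact aux _ _ _ (by simp [hs]))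
  have hinv : inv.comp (map R LinearMap.id g) = QuotientAddGroup.mk' _ :=
    hom_ext R fun m l => aux _ _ _ (by simp [hs])
  intro x
  constructor
  · intro hx
    have := DFunLike.congr_fun hinv x
    rw [AddMonoidHom.comp_apply, hx, map_zero] at this
    exact (QuotientAddGroup.eq_zero_iff x).1 this.symm
  · rintro ⟨y, rfl⟩
    rw [map_comp_apply, h.linearMap_comp_eq_zero, map_zero_right]

/-- Right exactness of `- ⊗_R L`. -/
theorem exact_map_left (L : Type u) [AddCommGroup L] [Module R L]
    {f : M →ₗ[Rᵐᵒᵖ] M'} {g : M' →ₗ[Rᵐᵒᵖ] M''} (h : Function.Exact f g)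
    (hg : Function.Surjective g) :
    Function.Exact (map R f (LinearMap.id : L →ₗ[R] L)) (map R g LinearMap.id) := by
  have key : ∀ (m : M') (l : L), g m = 0 →
      (tmul R m l : RingTensor R M' L) ∈ (map R f (LinearMap.id : L →ₗ[R] L)).range := by
    intro m l hl
    obtain ⟨a, rfl⟩ := (h m).1 hl
    exact ⟨tmul R a l, rfl⟩
  let s := Function.surjInv hg
  have hs : ∀ c, g (s c) = c := Function.surjInv_eq hg
  let Q := RingTensor R M' L ⧸ (map R f (LinearMap.id : L →ₗ[R] L)).range
  have aux : ∀ (m m' : M') (l : L), g m = g m' →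
      (QuotientAddGroup.mk (tmul R m l) : Q) = QuotientAddGroup.mk (tmul R m' l) := by
    intro m l l' e
    rw [← sub_eq_zero, ← QuotientAddGroup.mk_sub, QuotientAddGroup.eq_zero_iff, ← sub_tmul]
    exact key _ _ (by rw [map_sub, e, sub_self])
  let inv : RingTensor R M'' L →+ Q := lift (fun m c => QuotientAddGroup.mk (tmul R (s m) c))
    (fun m m' l => by
      rw [← QuotientAddGroup.mk_add, ← add_tmul]
      exact aux _ _ _ (by simp [hs]))
    (fun m l l' => by rw [tmul_add, QuotientAddGroup.mk_add])
    (fun m r l => by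
      rw [← smul_tmul]
      exact aux _ _ _ (by simp [hs]))
  have hinv : inv.comp (map R g LinearMap.id) = QuotientAddGroup.mk' _ :=
    hom_ext R fun m l => aux _ _ _ (by simp [hs])
  intro x
  constructor
  · intro hx
    have := DFunLike.congr_fun hinv x
    rw [AddMonoidHom.comp_apply, hx, map_zero] at this
    exact (QuotientAddGroup.eq_zero_iff x).1 this.symm
  · rintro ⟨y, rfl⟩
    rw [map_comp_apply, h.linearMap_comp_eq_zero, map_zero_left]

/-- The contraction `M ⊗_R L → M` along a linear form on `L`. -/
def contractRight (M : Type u) [AddCommGroup M] [Module Rᵐᵒᵖ M] (φ : L →ₗ[R] R) :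
    RingTensor R M L →+ M :=
  lift (fun m l => op (φ l) • m) (fun m m' l => smul_add _ _ _)
    (fun m l l' => by rw [map_add, MulOpposite.op_add, add_smul])
    (fun m r l => by rw [map_smul, smul_eq_mul, op_mul, mul_smul])

@[simp]
theorem contractRight_tmul (φ : L →ₗ[R] R) (m : M) (l : L) :
    contractRight M φ (tmul R m l) = op (φ l) • m := rfl

/-- The contraction `M ⊗_R L → L` along a linear form on `M`. -/
def contractLeft (L : Type u) [AddCommGroup L] [Module R L] (φ : M →ₗ[Rᵐᵒᵖ] Rᵐᵒᵖ) :
    RingTensor R M L →+ L :=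
  lift (fun m l => unop (φ m) • l) (fun m m' l => by rw [map_add, MulOpposite.unop_add, add_smul])
    (fun m l l' => smul_add _ _ _)
    (fun m r l => by rw [map_smul, smul_eq_mul, unop_mul, unop_op, mul_smul])

@[simp]
theorem contractLeft_tmul (φ : M →ₗ[Rᵐᵒᵖ] Rᵐᵒᵖ) (m : M) (l : L) :
    contractLeft L φ (tmul R m l) = unop (φ m) • l := rfl

theorem contractRight_map (φ : L →ₗ[R] R) (f : M →ₗ[Rᵐᵒᵖ] M') (x : RingTensor R M L) :
    contractRight M' φ (map R f LinearMap.id x) = f (contractRight M φ x) := by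
  have : (contractRight M' φ).comp (map R f LinearMap.id) =
      f.toAddMonoidHom.comp (contractRight M φ) := hom_ext R fun m l => by simp
  exact DFunLike.congr_fun this x

theorem eq_sum_contractRight {ι : Type*} [Fintype ι] {p : ι → L} {φ : ι → L →ₗ[R] R}
    (h : ∀ x, ∑ i, φ i x • p i = x) (x : RingTensor R M L) :
    ∑ i, tmul R (contractRight M (φ i) x) (p i) = x := by
  induction x using induction_on with
  | zero => simp [zero_tmul]
  | tmul m l => simp_rw [contractRight_tmul, smul_tmul, ← tmul_sum, h]
  | add x y hx hy => simp_rw [map_add, add_tmul, Finset.sum_add_distrib, hx, hy]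

/-- `-⊗_R P` preserves injectivity for a finitely generated projective module `P`. -/
theorem map_injective_of_dualBasis {ι : Type*} [Fintype ι] {p : ι → L} {φ : ι → L →ₗ[R] R}
    (h : ∀ x, ∑ i, φ i x • p i = x) {f : M →ₗ[Rᵐᵒᵖ] M'} (hf : Function.Injective f) :
    Function.Injective (map R f (LinearMap.id : L →ₗ[R] L)) := by
  rw [injective_iff_map_eq_zero]
  intro x hx
  rw [← eq_sum_contractRight h x]
  refine Finset.sum_eq_zero fun i _ => ?_
  have : contractRight M (φ i) x = 0 := hf (by rw [← contractRight_map, hx, map_zero, map_zero])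
  rw [this, zero_tmul]

end RingTensor

/-- The dual basis of a finitely generated projective module. -/
theorem exists_dualBasis (S : Type u) [Ring S] (P : Type u) [AddCommGroup P] [Module S P]
    [Module.Finite S P] [Module.Projective S P] :
    ∃ (n : ℕ) (p : Fin n → P) (φ : Fin n → P →ₗ[S] S), ∀ x, ∑ i, φ i x • p i = x := by
  obtain ⟨n, f, hf⟩ := Module.Finite.exists_fin' S P
  obtain ⟨s, hs⟩ := Module.projective_lifting_property f LinearMap.id hf
  refine ⟨n, fun i => f (Pi.single i 1), fun i => LinearMap.proj i ∘ₗ s, fun x => ?_⟩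
  have : f (s x) = x := DFunLike.congr_fun hs x
  conv_rhs => rw [← this, LinearMap.pi_apply_eq_sum_univ f (s x)]
  refine Finset.sum_congr rfl fun i _ => ?_
  simp only [LinearMap.comp_apply, LinearMap.proj_apply]
  congr 2
  ext j
  simp [Pi.single_apply, eq_comm]

/-! ### Weak flat and weak injective modules in terms of syzygies. -/

section Resolution

variable {R : Type u} [Ring R] {N : ModuleCat.{u} R} (P : ProjectiveResolution N)

instance (n : ℕ) : Module.Projective R (P.complex.X n) :=
  (IsProjective.iff_projective (P.complex.X n)).2 (P.projective n)

/-- The differential `P₂ → P₁`. -/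
abbrev d₂ : P.complex.X 2 →ₗ[R] P.complex.X 1 := (P.complex.d 2 1).hom

/-- The differential `P₁ → P₀`. -/
abbrev d₁ : P.complex.X 1 →ₗ[R] P.complex.X 0 := (P.complex.d 1 0).hom

theorem exact_d₂_d₁ : Function.Exact (d₂ P) (d₁ P) :=
  (ShortComplex.ShortExact.moduleCat_exact_iff_function_exact _).1 (P.exact_succ 0)

/-- The first syzygy, as a cokernel. -/
abbrev Syzygy : Type u := P.complex.X 1 ⧸ (d₂ P).range

/-- The inclusion of the first syzygy in `P₀`. -/
def syzygyEmb : Syzygy P →ₗ[R] P.complex.X 0 :=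
  (d₂ P).range.liftQ (d₁ P) (exact_d₂_d₁ P).linearMap_ker_eq.ge

theorem syzygyEmb_injective : Function.Injective (syzygyEmb P) := by
  rw [← LinearMap.ker_eq_bot]
  exact Submodule.ker_liftQ_eq_bot _ _ _ (exact_d₂_d₁ P).linearMap_ker_eq.le

theorem exact_d₂_mkQ : Function.Exact (d₂ P) (d₂ P).range.mkQ := by
  intro x
  simp

/-- This is what lets conditions on finitely presented modules control Tor₁: only these syzygies are
ever tested. -/
theorem syzygy_finitePresentation [Module.Finite R (P.complex.X 1)]
    [Module.Finite R (P.complex.X 2)] : Module.FinitePresentation R (Syzygy P) := by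
  have : Module.FinitePresentation R (P.complex.X 1) :=
    Module.finitePresentation_of_projective R _
  refine Module.finitePresentation_of_surjective (d₂ P).range.mkQ
    (Submodule.mkQ_surjective _) ?_
  rw [Submodule.ker_mkQ, LinearMap.range_eq_map]
  exact Module.Finite.fg_top.map _

theorem isZero_tor_one_iff (M : ModuleCat.{u} Rᵐᵒᵖ) :
    Limits.IsZero (Tor 1 M N) ↔
      Function.Exact (RingTensor.map R (LinearMap.id : M →ₗ[Rᵐᵒᵖ] M) (d₂ P))
        (RingTensor.map R LinearMap.id (d₁ P)) := by
  rw [Tor, (P.isoLeftDerivedObj (tensorLeft M) 1).isZero_iff]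
  change Limits.IsZero (HomologicalComplex.homology _ 1) ↔ _
  rw [← HomologicalComplex.exactAt_iff_isZero_homology,
    HomologicalComplex.exactAt_iff' _ 2 1 0 (by simp) (by simp),
    ShortComplex.ab_exact_iff_function_exact]
  rfl

/-- A module is weak flat if and only if `M ⊗ L → M ⊗ P₀` is injective for all syzygies `L` of
super finitely presented modules. -/
theorem weakFlat_iff_exact (M : ModuleCat.{u} Rᵐᵒᵖ) :
    weakFlat R M ↔ ∀ (N : ModuleCat.{u} R) (P : ProjectiveResolution N),
      (∀ n, Module.Finite R (P.complex.X n)) → ∀ x : RingTensor R M (P.complex.X 1),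
        RingTensor.map R LinearMap.id (d₁ P) x = 0 →
          ∃ z, RingTensor.map R LinearMap.id (d₂ P) z = x := by
  constructor
  · intro h N P hP x hx
    exact ((isZero_tor_one_iff P M).1 (h N ⟨P, hP⟩) x).1 hx
  · rintro h N ⟨P, hP⟩
    refine (isZero_tor_one_iff P M).2 fun x => ⟨h N P hP x, ?_⟩
    rintro ⟨z, rfl⟩
    rw [RingTensor.map_comp_apply, (exact_d₂_d₁ P).linearMap_comp_eq_zero,
      RingTensor.map_zero_right]

/-- By right exactness M ⊗ `Syzygy P` is the cokernel of M ⊗ P₂ → M ⊗ P₁, so exactness at M ⊗ P₁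
becomes injectivity on this cokernel. -/
theorem weakFlat_iff_injective (M : ModuleCat.{u} Rᵐᵒᵖ) :
    weakFlat R M ↔ ∀ (N : ModuleCat.{u} R) (P : ProjectiveResolution N),
      (∀ n, Module.Finite R (P.complex.X n)) → Function.Injective
        (RingTensor.map R (LinearMap.id : M →ₗ[Rᵐᵒᵖ] M) (syzygyEmb P)) := by
  rw [weakFlat_iff_exact]
  refine forall₃_congr fun N P hP => ?_
  have hex := RingTensor.exact_map_right M (exact_d₂_mkQ P) (Submodule.mkQ_surjective _)
  constructor
  · intro h
    rw [injective_iff_map_eq_zero]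
    intro y hy
    obtain ⟨x, rfl⟩ := RingTensor.map_surjective (f := (LinearMap.id : M →ₗ[Rᵐᵒᵖ] M))
      Function.surjective_id (Submodule.mkQ_surjective (d₂ P).range) y
    rw [RingTensor.map_comp_apply] at hy
    exact (hex x).2 (h x hy)
  · intro h x hx
    refine (hex x).1 (h ?_)
    rw [RingTensor.map_comp_apply, map_zero]
    exact hx

/-- Ext¹ consists of cocycles P₁ → X modulo those that factor through P₁ → P₀. -/
theorem weakInjective_iff_extends (X : ModuleCat.{u} R) :
    weakInjective R X ↔ ∀ (N : ModuleCat.{u} R) (P : ProjectiveResolution N),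
      (∀ n, Module.Finite R (P.complex.X n)) → ∀ f : P.complex.X 1 →ₗ[R] X,
        f ∘ₗ d₂ P = 0 → ∃ g : P.complex.X 0 →ₗ[R] X, g ∘ₗ d₁ P = f := by
  constructor
  · intro h N P hP f hf
    have := h N ⟨P, hP⟩
    have hf' : P.complex.d 2 1 ≫ ModuleCat.ofHom f = 0 := ModuleCat.hom_ext hf
    obtain ⟨g, hg⟩ := (P.extMk_eq_zero_iff (ModuleCat.ofHom f) 2 rfl hf' 0 rfl).1
      (Subsingleton.elim _ _)
    exact ⟨g.hom, congrArg ModuleCat.Hom.hom hg⟩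
  · rintro h N ⟨P, hP⟩
    refine subsingleton_of_forall_eq 0 fun α => ?_
    obtain ⟨f, hf, rfl⟩ := P.extMk_surjective α 2 rfl
    obtain ⟨g, hg⟩ := h N P hP f.hom (congrArg ModuleCat.Hom.hom hf)
    exact (P.extMk_eq_zero_iff f 2 rfl hf 0 rfl).2 ⟨ModuleCat.ofHom g, ModuleCat.hom_ext hg⟩

end Resolution

/-! ### Character modules and the duality between Hom and tensor. -/

section Character

/-- The group of characters of an abelian group. -/
abbrev Character (A : Type u) [AddCommGroup A] : Type u := A →+ AddCircle (1 : ℚ)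

theorem exists_character_ne_zero {A : Type u} [AddCommGroup A] {x : A} (hx : x ≠ 0) :
    ∃ χ : Character A, χ x ≠ 0 :=
  CharacterModule.exists_character_apply_ne_zero_of_ne_zero hx

theorem exists_character_extension_of_injective {A B : Type u} [AddCommGroup A] [AddCommGroup B]
    (f : A →+ B) (hf : Function.Injective f) (χ : Character A) :
    ∃ χ' : Character B, ∀ a, χ' (f a) = χ a := by
  obtain ⟨χ', h⟩ := CharacterModule.dual_surjective_of_injective f.toIntLinearMap hf χ
  exact ⟨χ', fun a => DFunLike.congr_fun h a⟩

theorem exists_character_extension {A B : Type u} [AddCommGroup A] [AddCommGroup B]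
    (f : A →+ B) (χ : Character A) (h : ∀ a, f a = 0 → χ a = 0) :
    ∃ χ' : Character B, ∀ a, χ' (f a) = χ a := by
  obtain ⟨χ', h'⟩ := exists_character_extension_of_injective (QuotientAddGroup.kerLift f)
    (QuotientAddGroup.kerLift_injective f) (QuotientAddGroup.lift f.ker χ h)
  exact ⟨χ', fun a => h' a⟩

/-- The character module of a right module, a left module. -/
def CharLeft (M : Type u) [AddCommGroup M] : Type u := Character M

/-- The character module of a left module, a right module. -/
def CharRight (L : Type u) [AddCommGroup L] : Type u := Character L

instance (M : Type u) [AddCommGroup M] : AddCommGroup (CharLeft M) :=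
  inferInstanceAs (AddCommGroup (Character M))

instance (M : Type u) [AddCommGroup M] : AddCommGroup (CharRight M) :=
  inferInstanceAs (AddCommGroup (Character M))

instance (M : Type u) [AddCommGroup M] : FunLike (CharLeft M) M (AddCircle (1 : ℚ)) :=
  inferInstanceAs (FunLike (Character M) M _)

instance (M : Type u) [AddCommGroup M] : AddMonoidHomClass (CharLeft M) M (AddCircle (1 : ℚ)) :=
  inferInstanceAs (AddMonoidHomClass (Character M) M _)

instance (M : Type u) [AddCommGroup M] : FunLike (CharRight M) M (AddCircle (1 : ℚ)) :=
  inferInstanceAs (FunLike (Character M) M _)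

instance (M : Type u) [AddCommGroup M] : AddMonoidHomClass (CharRight M) M (AddCircle (1 : ℚ)) :=
  inferInstanceAs (AddMonoidHomClass (Character M) M _)

variable {R : Type u} [Ring R]
variable {M M' L L' : Type u}
  [AddCommGroup M] [Module Rᵐᵒᵖ M] [AddCommGroup L] [Module R L]
  [AddCommGroup M'] [Module Rᵐᵒᵖ M'] [AddCommGroup L'] [Module R L']

instance : Module R (CharLeft M) where
  smul r χ := χ.comp (DistribSMul.toAddMonoidHom M (op r))
  one_smul χ := DFunLike.ext _ _ fun m => congrArg χ (one_smul Rᵐᵒᵖ m)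
  mul_smul r s χ := DFunLike.ext _ _ fun m => congrArg χ (mul_smul (op s) (op r) m)
  smul_zero _ := rfl
  smul_add _ _ _ := rfl
  add_smul r s χ := DFunLike.ext _ _ fun m =>
    (congrArg χ (add_smul (op r) (op s) m)).trans (map_add χ _ _)
  zero_smul χ := DFunLike.ext _ _ fun m => (congrArg χ (zero_smul Rᵐᵒᵖ m)).trans (map_zero χ)

instance : Module Rᵐᵒᵖ (CharRight L) where
  smul r χ := χ.comp (DistribSMul.toAddMonoidHom L (unop r))
  one_smul χ := DFunLike.ext _ _ fun m => congrArg χ (one_smul R m)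
  mul_smul r s χ := DFunLike.ext _ _ fun m => congrArg χ (mul_smul (unop s) (unop r) m)
  smul_zero _ := rfl
  smul_add _ _ _ := rfl
  add_smul r s χ := DFunLike.ext _ _ fun m =>
    (congrArg χ (add_smul (unop r) (unop s) m)).trans (map_add χ _ _)
  zero_smul χ := DFunLike.ext _ _ fun m => (congrArg χ (zero_smul R m)).trans (map_zero χ)

/-- A character of `M ⊗_R L` as a homomorphism `L → M⁺`. -/
def curryLeft (χ : Character (RingTensor R M L)) : L →ₗ[R] CharLeft M where
  toFun l := χ.comp ((RingTensor.tmulHom R).flip l)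
  map_add' l l' := DFunLike.ext _ _ fun m =>
    (congrArg χ (RingTensor.tmul_add m l l')).trans (map_add χ _ _)
  map_smul' r l := DFunLike.ext _ _ fun m => congrArg χ (RingTensor.smul_tmul r m l).symm

/-- A character of `M ⊗_R L` as a homomorphism `M → L⁺`. -/
def curryRight (χ : Character (RingTensor R M L)) : M →ₗ[Rᵐᵒᵖ] CharRight L where
  toFun m := χ.comp (RingTensor.tmulHom R m)
  map_add' m m' := DFunLike.ext _ _ fun l =>
    (congrArg χ (RingTensor.add_tmul m m' l)).trans (map_add χ _ _)
  map_smul' r m := DFunLike.ext _ _ fun l => congrArg χ (RingTensor.smul_tmul (unop r) m l)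

/-- A homomorphism `L → M⁺` as a character of `M ⊗_R L`. -/
def uncurryLeft (φ : L →ₗ[R] CharLeft M) : Character (RingTensor R M L) :=
  RingTensor.lift (fun m l => φ l m) (fun m m' l => map_add (φ l) m m')
    (fun m l l' => by rw [map_add]; rfl)
    (fun m r l => (DFunLike.congr_fun (map_smul φ r l) m).symm)

/-- A homomorphism `M → L⁺` as a character of `M ⊗_R L`. -/
def uncurryRight (ψ : M →ₗ[Rᵐᵒᵖ] CharRight L) : Character (RingTensor R M L) :=
  RingTensor.lift (fun m l => ψ m l) (fun m m' l => by rw [map_add]; rfl)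
    (fun m l l' => map_add (ψ m) l l') (fun m r l => by rw [map_smul]; rfl)

theorem uncurryLeft_comp (φ : L' →ₗ[R] CharLeft M) (g : L →ₗ[R] L') (x : RingTensor R M L) :
    uncurryLeft (φ ∘ₗ g) x = uncurryLeft φ (RingTensor.map R LinearMap.id g x) := by
  have : uncurryLeft (φ ∘ₗ g) = (uncurryLeft φ).comp (RingTensor.map R LinearMap.id g) :=
    RingTensor.hom_ext R fun _ _ => rfl
  exact DFunLike.congr_fun this x

theorem uncurryLeft_curryLeft (χ : Character (RingTensor R M L)) :
    uncurryLeft (curryLeft χ) = χ :=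
  RingTensor.hom_ext R fun _ _ => rfl

theorem uncurryRight_curryRight (χ : Character (RingTensor R M L)) :
    uncurryRight (curryRight χ) = χ :=
  RingTensor.hom_ext R fun _ _ => rfl

variable (R M) in
/-- The evaluation map `M → M⁺⁺`. -/
def doubleCharacter : M →ₗ[Rᵐᵒᵖ] CharRight (CharLeft M) where
  toFun m := AddMonoidHom.mk' (fun χ => χ m) fun _ _ => rfl
  map_add' m m' := DFunLike.ext _ _ fun χ => map_add χ m m'
  map_smul' _ _ := rfl

/-- Every character χ of M ⊗ L factors through M⁺⁺ ⊗ L, via e ⊗ l ↦ e(χ(- ⊗ l)), and characters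
separate points. -/
theorem doubleCharacter_pure (L : Type u) [AddCommGroup L] [Module R L] : Function.Injective
    (RingTensor.map R (doubleCharacter R M) (LinearMap.id : L →ₗ[R] L)) := by
  rw [injective_iff_map_eq_zero]
  intro x hx
  by_contra hne
  obtain ⟨χ, hχ⟩ := exists_character_ne_zero hne
  let ξ : Character (RingTensor R (CharRight (CharLeft M)) L) :=
    RingTensor.lift (fun e l => e (curryLeft χ l)) (fun _ _ _ => rfl)
      (fun e l l' => by rw [map_add, map_add]) (fun e r l => by rw [map_smul]; rfl)
  have : ξ.comp (RingTensor.map R (doubleCharacter R M) LinearMap.id) = χ :=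
    RingTensor.hom_ext R fun _ _ => rfl
  apply hχ
  rw [← this, AddMonoidHom.comp_apply, hx, map_zero]

/-- Homomorphisms A → L⁺ are characters of A ⊗ L. Purity keeps A ⊗ L → B ⊗ L injective, and
characters extend along injections. -/
theorem pureInjective_charRight (L : Type u) [AddCommGroup L] [Module R L] :
    PureInjectiveRight (ModuleCat.of Rᵐᵒᵖ (CharRight L)) := by
  rintro A B C f g ⟨⟨-, hfg, hg⟩, h⟩
  refine ⟨?_, ?_, ?_⟩
  · intro a b hab
    have := (ModuleCat.epi_iff_surjective g).2 hg
    exact (cancel_epi g).1 hab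
  · intro k
    constructor
    · intro hk
      have hk' : ∀ a, k.hom (f.hom a) = 0 := fun a => congrArg (fun t => t.hom a) hk
      have hker : LinearMap.ker g.hom ≤ LinearMap.ker k.hom := by
        intro b hb
        obtain ⟨a, rfl⟩ := (hfg b).1 hb
        exact hk' a
      refine ⟨ModuleCat.ofHom ((LinearMap.ker g.hom).liftQ k.hom hker ∘ₗ
        (g.hom.quotKerEquivOfSurjective hg).symm.toLinearMap), ?_⟩
      ext b
      change (LinearMap.ker g.hom).liftQ k.hom hker
        ((g.hom.quotKerEquivOfSurjective hg).symm (g.hom b)) = _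
      have : (g.hom.quotKerEquivOfSurjective hg).symm (g.hom b) =
          (LinearMap.ker g.hom).mkQ b := by
        rw [LinearEquiv.symm_apply_eq]; rfl
      rw [this]
      rfl
    · rintro ⟨t, rfl⟩
      ext a
      have : g.hom (f.hom a) = 0 := (hfg (f.hom a)).2 ⟨a, rfl⟩
      change t.hom (g.hom (f.hom a)) = 0
      rw [this, map_zero]
  · intro k
    obtain ⟨χ, hχ⟩ := exists_character_extension_of_injective _ (h (ModuleCat.of R L)).1
      (uncurryRight (L := L) k.hom)
    refine ⟨ModuleCat.ofHom (curryRight (L := L) χ), ?_⟩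
    ext a
    exact DFunLike.ext _ _ fun l => hχ (RingTensor.tmul R a l)

/-- The character module of a weak flat module is weak injective. -/
theorem weakInjective_charLeft {M : ModuleCat.{u} Rᵐᵒᵖ} (hM : weakFlat R M) :
    weakInjective R (ModuleCat.of R (CharLeft M)) := by
  rw [weakInjective_iff_extends]
  intro N P hP f hf
  -- Viewed as a character of M ⊗ P₁, `f` kills the image of M ⊗ P₂, which is the kernel of M ⊗ P₁ →
  -- M ⊗ P₀ by weak flatness.
  obtain ⟨χ, hχ⟩ := exists_character_extension
    (RingTensor.map R (LinearMap.id : M →ₗ[Rᵐᵒᵖ] M) (d₁ P)) (uncurryLeft (M := M) f) (by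
      intro x hx
      obtain ⟨z, rfl⟩ := (weakFlat_iff_exact M).1 hM N P hP x hx
      rw [← uncurryLeft_comp]
      have : uncurryLeft (M := M) (f ∘ₗ d₂ P) = 0 := by
        rw [hf]
        exact RingTensor.hom_ext R fun _ _ => rfl
      rw [this]; rfl)
  refine ⟨curryLeft (M := M) χ, LinearMap.ext fun l => DFunLike.ext _ _ fun m => ?_⟩
  exact hχ (RingTensor.tmul R m l)

end Character

/-! ### Finite presentations by matrices. -/

section Presentation

variable {S : Type u} [Ring S]

theorem exact_linearCombination_mkQ {m n : ℕ} (c : Fin n → Fin m → S) :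
    Function.Exact (Fintype.linearCombination S c)
      (LinearMap.range (Fintype.linearCombination S c)).mkQ := by
  intro x
  rw [Submodule.mkQ_apply, Submodule.Quotient.mk_eq_zero]
  rfl

theorem finitePresentation_quotient {m n : ℕ} (c : Fin n → Fin m → S) :
    Module.FinitePresentation S
      ((Fin m → S) ⧸ LinearMap.range (Fintype.linearCombination S c)) := by
  refine Module.finitePresentation_of_surjective (Submodule.mkQ _) (Submodule.mkQ_surjective _) ?_
  rw [Submodule.ker_mkQ, LinearMap.range_eq_map]
  exact Module.Finite.fg_top.map _

/-- A finitely presented module is the cokernel of a matrix. -/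
theorem exists_presentation (P : Type u) [AddCommGroup P] [Module S P]
    [Module.FinitePresentation S P] : ∃ (m n : ℕ) (c : Fin n → Fin m → S) (π : (Fin m → S) →ₗ[S] P),
      Function.Exact (Fintype.linearCombination S c) π ∧ Function.Surjective π := by
  obtain ⟨m, K, e, hK⟩ := Module.FinitePresentation.exists_fin S P
  obtain ⟨n, c, hc⟩ := Submodule.fg_iff_exists_fin_generating_family.1 hK
  refine ⟨m, n, c, e.symm.toLinearMap ∘ₗ K.mkQ, ?_, ?_⟩
  · rw [LinearMap.exact_iff, Fintype.range_linearCombination, hc, LinearEquiv.ker_comp,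
      Submodule.ker_mkQ]
  · exact e.symm.surjective.comp K.mkQ_surjective

end Presentation

/-! ### Equational purity. -/

section PureMap

variable {S : Type u} [Ring S] {A B C : Type u} [AddCommGroup A] [Module S A]
  [AddCommGroup B] [Module S B] [AddCommGroup C] [Module S C]

/-- Equational purity: finite systems of linear equations with constants in `A` that are solvable
in `B` are solvable in `A`. -/
def PureMap (f : A →ₗ[S] B) : Prop :=
  ∀ (m n : ℕ) (s : Fin m → Fin n → S) (a : Fin m → A),
    (∃ y : Fin n → B, ∀ i, ∑ j, s i j • y j = f (a i)) →
      ∃ y : Fin n → A, ∀ i, ∑ j, s i j • y j = a i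

theorem PureMap.injective {f : A →ₗ[S] B} (hf : PureMap f) : Function.Injective f := by
  rw [injective_iff_map_eq_zero]
  intro a ha
  -- The single equation 0 = a in no unknowns.
  obtain ⟨y, hy⟩ := hf 1 0 (fun _ => Fin.elim0) (fun _ => a) ⟨Fin.elim0, by simp [ha]⟩
  simpa using (hy 0).symm

/-- Finitely presented modules are projective relative to pure exact sequences. -/
theorem PureMap.exists_lift {f : A →ₗ[S] B} (hf : PureMap f) {g : B →ₗ[S] C}
    (hfg : Function.Exact f g) (hg : Function.Surjective g) (P : Type u) [AddCommGroup P]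
    [Module S P] [Module.FinitePresentation S P] (h : P →ₗ[S] C) :
    ∃ h' : P →ₗ[S] B, g ∘ₗ h' = h := by
  obtain ⟨m, n, c, π, hπ, hsurj⟩ := exists_presentation (S := S) P
  choose b hb using fun i => hg (h (π (Pi.single i 1)))
  have hgb : g ∘ₗ Fintype.linearCombination S b = h ∘ₗ π := by
    refine LinearMap.pi_ext' fun i => LinearMap.ext_ring ?_
    simp [hb]
  have hrel : ∀ k, π (c k) = 0 := fun k => (hπ _).2 ⟨Pi.single k 1, by simp⟩
  have : ∀ k, g (Fintype.linearCombination S b (c k)) = 0 := fun k => by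
    have := DFunLike.congr_fun hgb (c k)
    simp only [LinearMap.comp_apply] at this
    rw [this, hrel, map_zero]
  choose a ha using fun k => (hfg _).1 (this k)
  -- The lifts `b` of the generators violate the relations `c k` by f(a k), so they solve in B a
  -- system with constants from A. Subtracting a solution `y` in A corrects them without changing
  -- their images in C.
  obtain ⟨y, hy⟩ := hf n m c a ⟨b, fun k => by rw [ha]; rfl⟩
  let b' : Fin m → B := fun i => b i - f (y i)
  have hker : LinearMap.ker π ≤ LinearMap.ker (Fintype.linearCombination S b') := by
    intro v hv
    obtain ⟨w, rfl⟩ := (hπ v).1 hv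
    have h0 : ∀ k, Fintype.linearCombination S b' (c k) = 0 := fun k => by
      have := hy k
      have hak := ha k
      rw [← this, map_sum] at hak
      simp only [Fintype.linearCombination_apply, b', smul_sub, Finset.sum_sub_distrib] at hak ⊢
      rw [← hak]
      simp
    rw [LinearMap.mem_ker, Fintype.linearCombination_apply S c, map_sum]
    exact Finset.sum_eq_zero fun k _ => by rw [map_smul, h0, smul_zero]
  let e := π.quotKerEquivOfSurjective hsurj
  refine ⟨(LinearMap.ker π).liftQ _ hker ∘ₗ e.symm.toLinearMap, ?_⟩
  ext p
  obtain ⟨v, rfl⟩ := hsurj p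
  have he : e.symm (π v) = (LinearMap.ker π).mkQ v := by
    rw [LinearEquiv.symm_apply_eq]; rfl
  have hgb' : g ∘ₗ Fintype.linearCombination S b' = h ∘ₗ π := by
    rw [← hgb]
    refine LinearMap.pi_ext' fun i => LinearMap.ext_ring ?_
    have : g (f (y i)) = 0 := (hfg _).2 ⟨_, rfl⟩
    simp [b', this]
  rw [LinearMap.comp_apply, LinearMap.comp_apply, LinearEquiv.coe_coe, he]
  exact DFunLike.congr_fun hgb' v

theorem exact_rightComp {X A B C : ModuleCat.{u} S} {f : A ⟶ B} {g : B ⟶ C}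
    (hf : Function.Injective f.hom) (hfg : Function.Exact f.hom g.hom) :
    Function.Injective (Preadditive.rightComp X f) ∧
      Function.Exact (Preadditive.rightComp X f) (Preadditive.rightComp X g) := by
  constructor
  · intro a b hab
    have := (ModuleCat.mono_iff_injective f).2 hf
    exact (cancel_mono f).1 hab
  · intro k
    constructor
    · intro hk
      have hk' : ∀ x, k.hom x ∈ LinearMap.range f.hom := fun x =>
        (hfg _).1 (congrArg (fun t => t.hom x) hk)
      let e := LinearEquiv.ofInjective f.hom hf
      refine ⟨ModuleCat.ofHom (e.symm.toLinearMap ∘ₗ k.hom.codRestrict _ hk'), ?_⟩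
      ext x
      exact congrArg Subtype.val (e.apply_symm_apply (k.hom.codRestrict _ hk' x))
    · rintro ⟨t, rfl⟩
      ext x
      exact (hfg _).2 ⟨t.hom x, rfl⟩

end PureMap

/-! ### Equational purity against purity under tensor products. -/

section TensorPurity

variable {R : Type u} [Ring R]

section Left

variable {A B : Type u} [AddCommGroup A] [Module R A] [AddCommGroup B] [Module R B]

theorem contractLeft_map_linearCombination {m n : ℕ} (c : Fin n → Fin m → Rᵐᵒᵖ) (i : Fin m)
    (z : RingTensor R (Fin n → Rᵐᵒᵖ) A) :
    RingTensor.contractLeft A (LinearMap.proj i)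
        (RingTensor.map R (Fintype.linearCombination Rᵐᵒᵖ c) LinearMap.id z) =
      ∑ j, unop (c j i) • RingTensor.contractLeft A (LinearMap.proj j) z := by
  induction z using RingTensor.induction_on with
  | zero => simp
  | tmul v a =>
    simp [Fintype.linearCombination_apply, Finset.sum_smul, mul_smul]
  | add x y hx hy => simp only [map_add, hx, hy, smul_add, Finset.sum_add_distrib]

/-- Tensor with the cokernel Q of the coefficient matrix: Σ eᵢ ⊗ aᵢ vanishes in Q ⊗ A exactly when
the system is solvable in A. Solvability in B makes its image in Q ⊗ B zero. -/
theorem pureMap_of_map_injective_left {f : A →ₗ[R] B}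
    (hf : ∀ Q : ModuleCat.{u} Rᵐᵒᵖ,
      Function.Injective (RingTensor.map R (LinearMap.id : Q →ₗ[Rᵐᵒᵖ] Q) f)) : PureMap f := by
  rintro m n s a ⟨y, hy⟩
  let c : Fin n → Fin m → Rᵐᵒᵖ := fun j i => op (s i j)
  let ψ := Fintype.linearCombination Rᵐᵒᵖ c
  let π := (LinearMap.range ψ).mkQ
  have hex := exact_linearCombination_mkQ c
  let x : RingTensor R (Fin m → Rᵐᵒᵖ) A := ∑ i, RingTensor.tmul R (Pi.single i 1) (a i)
  have hc : ∀ j, ∑ i, op (s i j) • π (Pi.single i 1) = 0 := fun j => by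
    have h1 : π (c j) = 0 := (hex _).2 ⟨Pi.single j 1, by simp⟩
    rw [← h1, ← Finset.sum_congr rfl fun i _ => map_smul π _ _, ← map_sum]
    congr 1
    ext i
    simp [c, Pi.single_apply]
  have hx : RingTensor.map R π LinearMap.id x = 0 := by
    apply hf (ModuleCat.of Rᵐᵒᵖ ((Fin m → Rᵐᵒᵖ) ⧸ LinearMap.range ψ))
    rw [map_zero, RingTensor.map_comp_apply]
    simp only [x, map_sum, RingTensor.map_tmul, LinearMap.comp_apply, LinearMap.id_apply, ← hy,
      RingTensor.tmul_sum]
    simp only [← RingTensor.smul_tmul]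
    rw [Finset.sum_comm]
    refine Finset.sum_eq_zero fun j _ => ?_
    rw [← RingTensor.sum_tmul, hc, RingTensor.zero_tmul]
  obtain ⟨z, hz⟩ := (RingTensor.exact_map_left A hex (Submodule.mkQ_surjective _) x).1 hx
  refine ⟨fun j => RingTensor.contractLeft A (LinearMap.proj j) z, fun i => ?_⟩
  have := contractLeft_map_linearCombination c i z
  rw [hz] at this
  refine this.symm.trans ?_
  simp only [x, map_sum, RingTensor.contractLeft_tmul, LinearMap.proj_apply]
  rw [Finset.sum_eq_single i (fun k _ hk => by simp [hk.symm]) (by simp)]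
  simp

theorem pureProjectiveLeft_of_finitePresentation (P : ModuleCat.{u} R)
    [Module.FinitePresentation R P] : PureProjectiveLeft P := by
  rintro A B C f g ⟨⟨hf, hfg, hg⟩, h⟩
  obtain ⟨h₁, h₂⟩ := exact_rightComp (X := P) hf hfg
  refine ⟨h₁, h₂, fun k => ?_⟩
  obtain ⟨k', hk'⟩ := (pureMap_of_map_injective_left fun Q => (h Q).1).exists_lift hfg hg P k.hom
  exact ⟨ModuleCat.ofHom k', ModuleCat.hom_ext hk'⟩

end Left

section Right

variable {A B : Type u} [AddCommGroup A] [Module Rᵐᵒᵖ A] [AddCommGroup B] [Module Rᵐᵒᵖ B]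

theorem contractRight_map_linearCombination {m n : ℕ} (c : Fin n → Fin m → R) (i : Fin m)
    (z : RingTensor R A (Fin n → R)) :
    RingTensor.contractRight A (LinearMap.proj i)
        (RingTensor.map R LinearMap.id (Fintype.linearCombination R c) z) =
      ∑ j, op (c j i) • RingTensor.contractRight A (LinearMap.proj j) z := by
  induction z using RingTensor.induction_on with
  | zero => simp
  | tmul v a =>
    simp [Fintype.linearCombination_apply, Finset.sum_smul, mul_smul, Finset.op_sum]
  | add x y hx hy => simp only [map_add, hx, hy, smul_add, Finset.sum_add_distrib]

/-- The tensor lifts to A ⊗ Rᵐ, where it must come from A ⊗ Rⁿ; the coordinates of a preimage are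
the solution `y`. This translates purity on either side of a right module map into the other. -/
theorem sum_tmul_eq_zero_iff {m n : ℕ} {c : Fin n → Fin m → R} {L : Type u} [AddCommGroup L]
    [Module R L] {π : (Fin m → R) →ₗ[R] L} (hex : Function.Exact (Fintype.linearCombination R c) π)
    (hπ : Function.Surjective π) (a : Fin m → A) :
    ∑ i, RingTensor.tmul R (a i) (π (Pi.single i 1)) = 0 ↔
      ∃ y : Fin n → A, ∀ i, ∑ j, op (c j i) • y j = a i := by
  constructor
  · intro h
    let x : RingTensor R A (Fin m → R) := ∑ i, RingTensor.tmul R (a i) (Pi.single i 1)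
    have hx : RingTensor.map R LinearMap.id π x = 0 := by
      rw [← h]
      simp [x]
    obtain ⟨z, hz⟩ := (RingTensor.exact_map_right A hex hπ x).1 hx
    refine ⟨fun j => RingTensor.contractRight A (LinearMap.proj j) z, fun i => ?_⟩
    have := contractRight_map_linearCombination c i z
    rw [hz] at this
    refine this.symm.trans ?_
    simp only [x, map_sum, RingTensor.contractRight_tmul, LinearMap.proj_apply]
    rw [Finset.sum_eq_single i (fun k _ hk => by simp [hk.symm]) (by simp)]
    simp
  · rintro ⟨y, hy⟩
    simp only [← hy, RingTensor.sum_tmul, RingTensor.smul_tmul]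
    rw [Finset.sum_comm]
    refine Finset.sum_eq_zero fun j _ => ?_
    rw [← RingTensor.tmul_sum, ← Finset.sum_congr rfl fun i _ => map_smul π _ _, ← map_sum]
    have h1 : π (c j) = 0 := (hex _).2 ⟨Pi.single j 1, by simp⟩
    rw [← RingTensor.tmul_zero (y j), ← h1]
    congr 2
    ext i
    simp [Pi.single_apply]

theorem pureMap_of_map_injective_right {f : A →ₗ[Rᵐᵒᵖ] B}
    (hf : ∀ L : ModuleCat.{u} R,
      Function.Injective (RingTensor.map R f (LinearMap.id : L →ₗ[R] L))) : PureMap f := by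
  rintro m n s a ⟨y, hy⟩
  let c : Fin n → Fin m → R := fun j i => unop (s i j)
  have hex := exact_linearCombination_mkQ c
  refine (sum_tmul_eq_zero_iff hex (Submodule.mkQ_surjective _) a).1 ?_
  apply hf (ModuleCat.of R ((Fin m → R) ⧸ LinearMap.range (Fintype.linearCombination R c)))
  rw [map_sum, map_zero]
  exact (sum_tmul_eq_zero_iff hex (Submodule.mkQ_surjective _) _).2 ⟨y, hy⟩

theorem PureMap.map_injective {f : A →ₗ[Rᵐᵒᵖ] B} (hf : PureMap f) (L : Type u) [AddCommGroup L]
    [Module R L] [Module.FinitePresentation R L] :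
    Function.Injective (RingTensor.map R f (LinearMap.id : L →ₗ[R] L)) := by
  obtain ⟨m, n, c, π, hex, hπ⟩ := exists_presentation (S := R) L
  rw [injective_iff_map_eq_zero]
  intro x hx
  obtain ⟨x, rfl⟩ := RingTensor.map_surjective (f := (LinearMap.id : A →ₗ[Rᵐᵒᵖ] A))
    Function.surjective_id hπ x
  have hb : ∀ v : Fin m → R, ∑ i, (LinearMap.proj i : (Fin m → R) →ₗ[R] R) v •
      (Pi.single i 1 : Fin m → R) = v := fun v => (pi_eq_sum_univ' v).symm
  rw [← RingTensor.eq_sum_contractRight hb x] at hx ⊢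
  simp only [map_sum, RingTensor.map_tmul, LinearMap.id_apply] at hx ⊢
  rw [sum_tmul_eq_zero_iff hex hπ] at hx ⊢
  exact hf m n (fun i j => op (c j i)) _ hx

theorem pureProjectiveRight_of_finitePresentation (P : ModuleCat.{u} Rᵐᵒᵖ)
    [Module.FinitePresentation Rᵐᵒᵖ P] : PureProjectiveRight P := by
  rintro A B C f g ⟨⟨hf, hfg, hg⟩, h⟩
  obtain ⟨h₁, h₂⟩ := exact_rightComp (X := P) hf hfg
  refine ⟨h₁, h₂, fun k => ?_⟩
  obtain ⟨k', hk'⟩ := (pureMap_of_map_injective_right fun Q => (h Q).1).exists_lift hfg hg P k.hom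
  exact ⟨ModuleCat.ofHom k', ModuleCat.hom_ext hk'⟩

end Right

end TensorPurity

/-! ### Criteria for weak flatness. -/

section Criteria

variable {R : Type u} [Ring R]

/-- A module is weak flat if every homomorphism to it from a finitely presented module factors
through a weak flat module. -/
theorem weakFlat_of_factors (M : ModuleCat.{u} Rᵐᵒᵖ)
    (h : ∀ L : ModuleCat.{u} Rᵐᵒᵖ, Module.FinitePresentation Rᵐᵒᵖ L → ∀ f : L →ₗ[Rᵐᵒᵖ] M,
      ∃ W : ModuleCat.{u} Rᵐᵒᵖ, weakFlat R W ∧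
        ∃ (a : L →ₗ[Rᵐᵒᵖ] W) (b : W →ₗ[Rᵐᵒᵖ] M), b ∘ₗ a = f) :
    weakFlat R M := by
  rw [weakFlat_iff_exact]
  intro N P hP x hx
  obtain ⟨k, m, g, rfl⟩ := RingTensor.exists_sum x
  obtain ⟨n, p, φ, hφ⟩ := exists_dualBasis R (P.complex.X 0)
  -- Contracting the vanishing tensor in M ⊗ P₀ with the dual basis gives finitely many relations
  -- among the `m i`. The module presented by exactly these relations maps to M by eᵢ ↦ m i.
  let c : Fin n → Fin k → Rᵐᵒᵖ := fun j i => op (φ j (d₁ P (g i)))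
  let ψ := Fintype.linearCombination Rᵐᵒᵖ c
  let π := (LinearMap.range ψ).mkQ
  have hex := exact_linearCombination_mkQ c
  have hm : ∀ j, ∑ i, c j i • m i = 0 := fun j => by
    have := congrArg (RingTensor.contractRight M (φ j)) hx
    simpa using this
  have hker : LinearMap.range ψ ≤ LinearMap.ker (Fintype.linearCombination Rᵐᵒᵖ m) := by
    rintro _ ⟨v, rfl⟩
    rw [LinearMap.mem_ker, Fintype.linearCombination_apply Rᵐᵒᵖ c, map_sum]
    exact Finset.sum_eq_zero fun k _ => by
      rw [map_smul, Fintype.linearCombination_apply, hm, smul_zero]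
  obtain ⟨W, hW, a, b, hab⟩ := h (ModuleCat.of Rᵐᵒᵖ ((Fin k → Rᵐᵒᵖ) ⧸ LinearMap.range ψ))
    (finitePresentation_quotient c) ((LinearMap.range ψ).liftQ _ hker)
  -- A generic form of the given tensor: it maps to it over M, yet already dies after tensoring with
  -- P₀. Exactness for `W` then yields a preimage, which is carried on to M.
  let y : RingTensor R ((Fin k → Rᵐᵒᵖ) ⧸ LinearMap.range ψ) (P.complex.X 1) :=
    ∑ i, RingTensor.tmul R (π (Pi.single i 1)) (g i)
  have hy : RingTensor.map R LinearMap.id (d₁ P) y = 0 := by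
    have hi : ∀ i, RingTensor.tmul R (π (Pi.single i 1)) (d₁ P (g i)) =
        ∑ j, RingTensor.tmul R (op (φ j (d₁ P (g i))) • π (Pi.single i 1)) (p j) := fun i => by
      conv_lhs => rw [← hφ (d₁ P (g i))]
      simp_rw [RingTensor.tmul_sum, ← RingTensor.smul_tmul]
    simp only [y, map_sum, RingTensor.map_tmul, LinearMap.id_apply, hi]
    rw [Finset.sum_comm]
    refine Finset.sum_eq_zero fun j _ => ?_
    rw [← RingTensor.sum_tmul, show ∑ i, op (φ j (d₁ P (g i))) • π (Pi.single i 1) = 0 by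
      have h1 : π (c j) = 0 := (hex _).2 ⟨Pi.single j 1, by simp⟩
      rw [← h1, ← Finset.sum_congr rfl fun i _ => map_smul π _ _, ← map_sum]
      congr 1
      ext i
      simp [c, Pi.single_apply], RingTensor.zero_tmul]
  obtain ⟨z, hz⟩ := (weakFlat_iff_exact W).1 hW N P hP (RingTensor.map R a LinearMap.id y) (by
    rw [RingTensor.map_swap, hy, map_zero])
  refine ⟨RingTensor.map R b LinearMap.id z, ?_⟩
  rw [RingTensor.map_swap, hz, RingTensor.map_comp_apply, hab, map_sum]
  refine Finset.sum_congr rfl fun i _ => ?_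
  change RingTensor.tmul R (Fintype.linearCombination Rᵐᵒᵖ m (Pi.single i 1)) (g i) = _
  simp

/-- A pure submodule of a weak flat module is weak flat. -/
theorem weakFlat_of_map_injective {M W : ModuleCat.{u} Rᵐᵒᵖ} (hW : weakFlat R W)
    (f : M →ₗ[Rᵐᵒᵖ] W) (hf : ∀ L : ModuleCat.{u} R, Module.FinitePresentation R L →
      Function.Injective (RingTensor.map R f (LinearMap.id : L →ₗ[R] L))) : weakFlat R M := by
  rw [weakFlat_iff_injective] at hW ⊢
  intro N P hP
  have h₁ := hf (ModuleCat.of R (Syzygy P)) (syzygy_finitePresentation P)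
  rw [injective_iff_map_eq_zero] at h₁ ⊢
  intro x hx
  refine h₁ x (hW N P hP ?_)
  rw [RingTensor.map_swap, hx, map_zero, map_zero]

/-- For L a syzygy, weak injectivity extends η along L → P₀. Hence M ⊗ η factors through M ⊗ L → M ⊗
P₀, and its injectivity passes to that map. -/
theorem weakFlat_of_weakInjective_envelopes {M : ModuleCat.{u} Rᵐᵒᵖ}
    (h : ∀ L : ModuleCat.{u} R, Module.FinitePresentation R L → ∃ W : ModuleCat.{u} R,
      weakInjective R W ∧ ∃ η : L →ₗ[R] W,
        Function.Injective (RingTensor.map R (LinearMap.id : M →ₗ[Rᵐᵒᵖ] M) η)) :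
    weakFlat R M := by
  rw [weakFlat_iff_injective]
  intro N P hP
  obtain ⟨W, hW, η, hη⟩ := h (ModuleCat.of R (Syzygy P)) (syzygy_finitePresentation P)
  obtain ⟨g, hg⟩ := (weakInjective_iff_extends W).1 hW N P hP (η ∘ₗ (d₂ P).range.mkQ) (by
    ext x
    have : (d₂ P).range.mkQ (d₂ P x) = 0 := (exact_d₂_mkQ P _).2 ⟨x, rfl⟩
    rw [LinearMap.comp_apply, LinearMap.comp_apply, this, map_zero]
    rfl)
  have hg' : g ∘ₗ syzygyEmb P = η := by
    rw [← LinearMap.cancel_right (Submodule.mkQ_surjective (d₂ P).range)]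
    exact hg
  rw [injective_iff_map_eq_zero] at hη ⊢
  intro x hx
  refine hη x ?_
  have := RingTensor.map_comp_apply (R := R) (LinearMap.id : M →ₗ[Rᵐᵒᵖ] M) LinearMap.id
    (syzygyEmb P) g x
  rw [hx, map_zero, hg'] at this
  exact this.symm

end Criteria

/-! ### Closure of both classes under pure submodules and products, and of weak flatness under pure
quotients. -/

section PureClosure

variable {S : Type u} [Ring S] {A B C : Type u} [AddCommGroup A] [Module S A]
  [AddCommGroup B] [Module S B] [AddCommGroup C] [Module S C]

theorem PureMap.comp {f : A →ₗ[S] B} {g : B →ₗ[S] C} (hg : PureMap g) (hf : PureMap f) :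
    PureMap (g ∘ₗ f) := fun m n s a h => hf m n s a (hg m n s _ h)

theorem pureMap_linearEquiv (e : A ≃ₗ[S] B) : PureMap e.toLinearMap := by
  rintro m n s a ⟨y, hy⟩
  refine ⟨fun j => e.symm (y j), fun i => e.injective ?_⟩
  simpa using hy i

end PureClosure

section Closure

variable {R : Type u} [Ring R]

theorem weakFlat_of_pureMap {M W : ModuleCat.{u} Rᵐᵒᵖ} {f : M →ₗ[Rᵐᵒᵖ] W} (hf : PureMap f)
    (hW : weakFlat R W) : weakFlat R M :=
  weakFlat_of_map_injective hW f fun L _ => hf.map_injective L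

theorem weakFlat_of_pureQuotient {A B C : ModuleCat.{u} Rᵐᵒᵖ} {f : A →ₗ[Rᵐᵒᵖ] B}
    {g : B →ₗ[Rᵐᵒᵖ] C} (hf : PureMap f) (hfg : Function.Exact f g) (hg : Function.Surjective g)
    (hB : weakFlat R B) : weakFlat R C :=
  weakFlat_of_factors C fun L _ h =>
    let ⟨h', e⟩ := hf.exists_lift hfg hg L h
    ⟨B, hB, h', g, e⟩

/-- Extending a map from P₁ to P₀ is a finite linear system: the unknowns are the values on a dual
basis of P₀, with one equation per generator of P₁. It is solvable in W, hence in M. -/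
theorem weakInjective_of_pureMap {M W : ModuleCat.{u} R} {f : M →ₗ[R] W} (hf : PureMap f)
    (hW : weakInjective R W) : weakInjective R M := by
  rw [weakInjective_iff_extends] at hW ⊢
  intro N P hP h hh
  obtain ⟨g, hg⟩ := hW N P hP (f ∘ₗ h) (by rw [LinearMap.comp_assoc, hh, LinearMap.comp_zero])
  obtain ⟨n, p, φ, hφ⟩ := exists_dualBasis R (P.complex.X 0)
  obtain ⟨m, q, hq⟩ := Module.Finite.exists_fin (R := R) (M := P.complex.X 1)
  obtain ⟨y, hy⟩ := hf m n (fun i j => φ j (d₁ P (q i))) (fun i => h (q i))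
    ⟨fun j => g (p j), fun i => by
      have := DFunLike.congr_fun hg (q i)
      simp only [LinearMap.comp_apply] at this
      rw [← this]
      conv_rhs => rw [← hφ (d₁ P (q i)), map_sum]
      simp only [map_smul]⟩
  refine ⟨∑ j, (φ j).smulRight (y j), LinearMap.ext_on_range hq fun i => ?_⟩
  simpa using hy i

theorem weakInjective_pi {ι : Type u} (X : ι → ModuleCat.{u} R) (hX : ∀ i, weakInjective R (X i)) :
    weakInjective R (ModuleCat.of R (∀ i, X i)) := by
  rw [weakInjective_iff_extends]
  intro N P hP f hf
  have hX' := fun i => (weakInjective_iff_extends (X i)).1 (hX i) N P hP (LinearMap.proj i ∘ₗ f)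
    (by rw [LinearMap.comp_assoc, hf, LinearMap.comp_zero])
  choose g hg using hX'
  refine ⟨LinearMap.pi g, ?_⟩
  ext x i
  exact DFunLike.congr_fun (hg i) x

/-- Tensoring with a finitely generated projective commutes with products, so componentwise
preimages assemble through the dual basis of P₂ and are compared through that of P₁. -/
theorem weakFlat_pi {ι : Type u} (X : ι → ModuleCat.{u} Rᵐᵒᵖ) (hX : ∀ i, weakFlat R (X i)) :
    weakFlat R (ModuleCat.of Rᵐᵒᵖ (∀ i, X i)) := by
  rw [weakFlat_iff_exact]
  intro N P hP x hx
  let pr : ∀ i, (∀ i, X i) →ₗ[Rᵐᵒᵖ] X i := fun i => LinearMap.proj i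
  have hX' := fun i => (weakFlat_iff_exact (X i)).1 (hX i) N P hP
    (RingTensor.map R (pr i) LinearMap.id x)
    (by rw [RingTensor.map_swap]; exact (congrArg _ hx).trans (map_zero _))
  choose z hz using hX'
  obtain ⟨n, p, φ, hφ⟩ := exists_dualBasis R (P.complex.X 1)
  obtain ⟨n', p', φ', hφ'⟩ := exists_dualBasis R (P.complex.X 2)
  let w : RingTensor R (∀ i, X i) (P.complex.X 2) :=
    ∑ j, RingTensor.tmul R (fun i => RingTensor.contractRight (X i) (φ' j) (z i)) (p' j)
  have hw : ∀ i, RingTensor.map R (pr i) LinearMap.id w = z i := fun i => by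
    rw [← RingTensor.eq_sum_contractRight hφ' (z i), map_sum]
    rfl
  refine ⟨w, ?_⟩
  change RingTensor.map R (LinearMap.id : (∀ i, X i) →ₗ[Rᵐᵒᵖ] _) (d₂ P) w = x
  rw [← RingTensor.eq_sum_contractRight hφ x, ← RingTensor.eq_sum_contractRight hφ
    (RingTensor.map R (LinearMap.id : (∀ i, X i) →ₗ[Rᵐᵒᵖ] _) (d₂ P) w)]
  refine Finset.sum_congr rfl fun j _ => congrArg (RingTensor.tmul R · (p j)) ?_
  have : ∀ i, pr i (RingTensor.contractRight (∀ i, X i) (φ j)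
      (RingTensor.map R LinearMap.id (d₂ P) w)) =
        pr i (RingTensor.contractRight (∀ i, X i) (φ j) x) := fun i => by
    rw [← RingTensor.contractRight_map, ← RingTensor.contractRight_map, ← RingTensor.map_swap,
      hw, hz]
  exact funext this

end Closure

/-! ### Small pure submodules by a Löwenheim–Skolem argument. -/

section LowenheimSkolem

open Cardinal

variable (S : Type u)

/-- Function symbols for linear combinations and for solutions of finite linear systems. -/
def systemLanguage : FirstOrder.Language.{u, 0} where
  -- `inl (n, j, l)` stands for entry `j` of a chosen solution in `n` unknowns with coefficient rows
  -- `l`, the arguments being the constants; `inr l` is a linear combination. Lists are padded by 0,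
  -- so all arities can share the same symbols.
  Functions _ := (ℕ × ℕ × List (List S)) ⊕ List S
  Relations _ := Empty

theorem mk_systemLanguage_functions_le {κ : Cardinal.{u}} (hκ : ℵ₀ ≤ κ) (hS : #S ≤ κ) :
    #(Σ n, (systemLanguage S).Functions n) ≤ κ := by
  have hl : ∀ {X : Type u}, #X ≤ κ → #(List X) ≤ κ := fun h =>
    (mk_list_le_max _).trans (max_le hκ h)
  have h1 : #(ℕ × ℕ × List (List S)) ≤ κ := by
    simp only [mk_prod, lift_uzero, mk_nat, lift_aleph0]
    exact mul_le_of_le hκ hκ (mul_le_of_le hκ hκ (hl (hl hS)))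
  have h2 : #((ℕ × ℕ × List (List S)) ⊕ List S) ≤ κ := by
    rw [mk_sum, lift_id, lift_id]
    exact add_le_of_le hκ h1 (hl hS)
  have h3 : #(Σ n, (systemLanguage S).Functions n) =
      #(ℕ × ((ℕ × ℕ × List (List S)) ⊕ List S)) :=
    mk_congr (Equiv.sigmaEquivProd _ _)
  rw [h3, mk_prod, mk_nat, lift_aleph0, lift_uzero]
  exact mul_le_of_le hκ hκ h2

variable [Ring S]

open Classical in
/-- The interpretation of linear combinations and of chosen solutions of linear systems. -/
@[reducible]
noncomputable def systemStructure (V : Type u) [AddCommGroup V] [Module S V] :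
    (systemLanguage S).Structure V where
  funMap {m} t a := match t with
    | Sum.inl (n, j, l) =>
      if h : ∃ y : ℕ → V, ∀ i : Fin m,
        ∑ j : Fin n, ((l.getD i []).getD j 0) • y j = a i then h.choose j else 0
    | Sum.inr l => ∑ i : Fin m, l.getD i 0 • a i
  RelMap {_} r _ := r.elim

open Classical in
/-- Every small subset of a module is contained in a small pure submodule. -/
theorem exists_small_pure_submodule (V : Type u) [AddCommGroup V] [Module S V] (s : Set V)
    {κ : Cardinal.{u}} (hκ : ℵ₀ ≤ κ) (hS : #S ≤ κ) (hs : #s ≤ κ) :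
    ∃ U : Submodule S V, s ⊆ U ∧ #U ≤ κ ∧ PureMap U.subtype := by
  let _ := systemStructure S V
  -- Closed under linear combinations, hence a submodule; closed under the chosen solutions, hence
  -- pure.
  let T := FirstOrder.Language.Substructure.closure (systemLanguage S) s
  have hlin : ∀ {m : ℕ} (l : List S) (a : Fin m → V), (∀ i, a i ∈ T) →
      ∑ i : Fin m, l.getD i 0 • a i ∈ T := fun {m} l a ha =>
    T.fun_mem (n := m) (Sum.inr l) a ha
  let U : Submodule S V :=
    { carrier := T
      add_mem' := fun {a b} ha hb => by
        have := hlin [1, 1] ![a, b] (by simp [Fin.forall_fin_two]; exact ⟨ha, hb⟩)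
        simpa [Fin.sum_univ_two] using this
      zero_mem' := by
        have := hlin [] (fun i : Fin 0 => i.elim0) (fun i => i.elim0)
        simpa using this
      smul_mem' := fun c a ha => by
        have := hlin [c] ![a] (by simpa using ha)
        simpa using this }
  refine ⟨U, FirstOrder.Language.Substructure.subset_closure, ?_, ?_⟩
  · have h := FirstOrder.Language.Substructure.lift_card_closure_le (L := systemLanguage S) (s := s)
    simp only [lift_id] at h
    refine le_trans h (max_le hκ (add_le_of_le hκ hs (mk_systemLanguage_functions_le S hκ hS)))
  · rintro m n c a ⟨y, hy⟩
    let l : List (List S) := List.ofFn fun i => List.ofFn (c i)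
    have hl : ∀ (i : Fin m) (j : Fin n), (l.getD i []).getD j 0 = c i j := fun i j => by
      simp [l, List.getD]
    have hex : ∃ y : ℕ → V, ∀ i : Fin m,
        ∑ j : Fin n, ((l.getD i []).getD j 0) • y j = (a i : V) := by
      refine ⟨fun k => if h : k < n then y ⟨k, h⟩ else 0, fun i => ?_⟩
      simp only [hl]
      simpa using hy i
    have hmem : ∀ j, hex.choose j ∈ U := fun j => by
      have := T.fun_mem (n := m) (Sum.inl (n, j, l)) (fun i => (a i : V)) (fun i => (a i).2)
      change (if h : ∃ y : ℕ → V, ∀ i : Fin m,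
        ∑ j : Fin n, ((l.getD i []).getD j 0) • y j = (a i : V) then h.choose j else 0) ∈ T at this
      rwa [dif_pos hex] at this
    refine ⟨fun j => ⟨hex.choose j, hmem j⟩, fun i => Subtype.ext ?_⟩
    have := hex.choose_spec i
    simp only [hl] at this
    simpa using this

end LowenheimSkolem

/-! ### Preenvelopes from a solution set. -/

section Envelope

open Cardinal

variable {S : Type u} [Ring S]

/-- A module of cardinality at most `#X` is a quotient of the free module on `X`. -/
theorem exists_surjective_of_mk_le (X : Type u) (U : Type u) [AddCommGroup U] [Module S U]
    (h : #U ≤ #X) : ∃ p : (X →₀ S) →ₗ[S] U, Function.Surjective p := by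
  obtain ⟨i⟩ := h
  refine ⟨Finsupp.linearCombination S (Function.invFun i), fun x => ?_⟩
  exact ⟨Finsupp.single (i x) 1, by simp [Function.leftInverse_invFun i.injective x]⟩

variable {𝒞 : ObjectProperty (ModuleCat.{u} S)}

/-- A solution set of homomorphisms gives a preenvelope. -/
theorem preenvelope_of_solutionSet
    (hpi : ∀ {ι : Type u} (X : ι → ModuleCat.{u} S), (∀ i, 𝒞 (X i)) →
      𝒞 (ModuleCat.of S (∀ i, X i))) {M : ModuleCat.{u} S} {ι : Type u}
    (Y : ι → ModuleCat.{u} S) (hY : ∀ i, 𝒞 (Y i)) (g : ∀ i, M ⟶ Y i)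
    (h : ∀ V, 𝒞 V → ∀ f : M ⟶ V, ∃ (i : ι) (k : Y i ⟶ V), g i ≫ k = f) :
    ∃ (W : ModuleCat.{u} S) (η : M ⟶ W), 𝒞 W ∧
      ∀ V, 𝒞 V → Function.Surjective (Preadditive.leftComp V η) := by
  refine ⟨ModuleCat.of S (∀ i, Y i), ModuleCat.ofHom (LinearMap.pi fun i => (g i).hom), hpi Y hY,
    fun V hV f => ?_⟩
  obtain ⟨i, k, rfl⟩ := h V hV f
  exact ⟨ModuleCat.ofHom (LinearMap.proj i) ≫ k, rfl⟩

/-- A class closed under pure submodules and products is preenveloping. -/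
theorem exists_preenvelope
    (hpure : ∀ {A B : ModuleCat.{u} S} {f : A →ₗ[S] B}, PureMap f → 𝒞 B → 𝒞 A)
    (hpi : ∀ {ι : Type u} (X : ι → ModuleCat.{u} S), (∀ i, 𝒞 (X i)) →
      𝒞 (ModuleCat.of S (∀ i, X i))) (M : ModuleCat.{u} S) :
    ∃ (W : ModuleCat.{u} S) (η : M ⟶ W), 𝒞 W ∧
      ∀ V, 𝒞 V → Function.Surjective (Preadditive.leftComp V η) := by
  let X : Type u := ULift.{u} ℕ ⊕ S ⊕ M
  let F := X →₀ S
  -- Any map from M to a module in `𝒞` lands in a pure submodule of cardinality at most #X, which is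
  -- isomorphic to a quotient of `F`. Hence this index in `Type u` already meets every map.
  let ι := Σ U : {U : Submodule S F // 𝒞 (ModuleCat.of S (F ⧸ U))}, M →ₗ[S] F ⧸ U.1
  refine preenvelope_of_solutionSet hpi (ι := ι) (fun i => ModuleCat.of S (F ⧸ i.1.1))
    (fun i => i.1.2) (fun i => ModuleCat.ofHom i.2) fun V hV f => ?_
  have hX : ℵ₀ ≤ #X := by
    rw [aleph0_le_mk_iff]
    infer_instance
  obtain ⟨U, hfU, hcard, hU⟩ := exists_small_pure_submodule S V (Set.range f.hom) hX
    (mk_le_of_injective (Sum.inr_injective.comp Sum.inl_injective))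
    (mk_range_le.trans (mk_le_of_injective (Sum.inr_injective.comp Sum.inr_injective)))
  obtain ⟨p, hp⟩ := exists_surjective_of_mk_le (S := S) X U hcard
  let e := p.quotKerEquivOfSurjective hp
  have hK : 𝒞 (ModuleCat.of S (F ⧸ LinearMap.ker p)) :=
    hpure (B := V) (hU.comp (pureMap_linearEquiv e)) hV
  let i : ι := ⟨⟨LinearMap.ker p, hK⟩,
    e.symm.toLinearMap ∘ₗ f.hom.codRestrict U fun x => hfU ⟨x, rfl⟩⟩
  refine ⟨i, ModuleCat.ofHom (U.subtype ∘ₗ e.toLinearMap), ?_⟩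
  ext x
  exact congrArg Subtype.val (e.apply_symm_apply (f.hom.codRestrict U (fun x => hfU ⟨x, rfl⟩) x))

end Envelope

/-! ### Resolutions spliced from preenvelopes and precovers. -/

section ExistsResolution

variable {S : Type u} [Ring S] {𝒞 : ObjectProperty (ModuleCat.{u} S)}

open Limits

theorem nonempty_rightResolution
    (h : ∀ M : ModuleCat.{u} S, ∃ (W : ModuleCat.{u} S) (η : M ⟶ W), 𝒞 W ∧
      ∀ V, 𝒞 V → Function.Surjective (Preadditive.leftComp V η)) (M : ModuleCat.{u} S) :
    Nonempty (RightResolution 𝒞 M) := by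
  choose W η hW hη using h
  let C : ℕ → ModuleCat.{u} S := fun n => Nat.rec M (fun _ X => cokernel (η X)) n
  let d : ∀ A, W A ⟶ W (cokernel (η A)) := fun A => cokernel.π (η A) ≫ η (cokernel (η A))
  have key : ∀ (A : ModuleCat.{u} S) (V : ModuleCat.{u} S), 𝒞 V →
      Function.Exact (Preadditive.leftComp V (cokernel.π (η A) ≫ η (cokernel (η A))))
        (Preadditive.leftComp V (η A)) := by
    intro A V hV f
    constructor
    · intro hf
      obtain ⟨g, hg⟩ := hη (cokernel (η A)) V hV (cokernel.desc (η A) f hf)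
      refine ⟨g, ?_⟩
      change (cokernel.π (η A) ≫ η (cokernel (η A))) ≫ g = f
      rw [Category.assoc]
      exact (congrArg _ hg).trans (cokernel.π_desc _ _ _)
    · rintro ⟨g, rfl⟩
      change η A ≫ (cokernel.π (η A) ≫ η (cokernel (η A))) ≫ g = 0
      simp
  exact ⟨{
    W := fun n => W (C n)
    mem := fun n => hW _
    d := fun n => d (C n)
    η := η M
    d_comp_d := fun n => by
      change (cokernel.π (η (C n)) ≫ η (cokernel (η (C n)))) ≫
        cokernel.π (η (cokernel (η (C n)))) ≫ _ = 0
      simp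
    η_comp_d := by
      change η M ≫ cokernel.π (η M) ≫ _ = 0
      simp
    surjective := fun V hV => hη M V hV
    exact_zero := fun V hV => key M V hV
    exact_succ := fun V hV n f => by
      constructor
      · intro hf
        -- The differential is a cokernel projection followed by the next preenvelope; cancelling
        -- the epimorphism leaves the exactness already known one stage later.
        refine (key (cokernel (η (C n))) V hV f).1 ?_
        have hf' : (cokernel.π (η (C n)) ≫ η (cokernel (η (C n)))) ≫ f = 0 := hf
        rw [Category.assoc] at hf'
        exact zero_of_epi_comp _ hf'
      · rintro ⟨g, rfl⟩
        change (cokernel.π (η (C n)) ≫ η (cokernel (η (C n)))) ≫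
          (cokernel.π (η (cokernel (η (C n)))) ≫ _) ≫ g = 0
        simp }⟩

theorem nonempty_leftResolution
    (h : ∀ M : ModuleCat.{u} S, ∃ (W : ModuleCat.{u} S) (ε : W ⟶ M), 𝒞 W ∧
      ∀ V, 𝒞 V → Function.Surjective (Preadditive.rightComp V ε)) (M : ModuleCat.{u} S) :
    Nonempty (LeftResolution 𝒞 M) := by
  choose W ε hW hε using h
  let C : ℕ → ModuleCat.{u} S := fun n => Nat.rec M (fun _ X => kernel (ε X)) n
  let d : ∀ A, W (kernel (ε A)) ⟶ W A := fun A => ε (kernel (ε A)) ≫ kernel.ι (ε A)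
  have key : ∀ (A : ModuleCat.{u} S) (V : ModuleCat.{u} S), 𝒞 V →
      Function.Exact (Preadditive.rightComp V (ε (kernel (ε A)) ≫ kernel.ι (ε A)))
        (Preadditive.rightComp V (ε A)) := by
    intro A V hV f
    constructor
    · intro hf
      obtain ⟨g, hg⟩ := hε (kernel (ε A)) V hV (kernel.lift (ε A) f hf)
      refine ⟨g, ?_⟩
      change g ≫ ε (kernel (ε A)) ≫ kernel.ι (ε A) = f
      rw [← Category.assoc]
      exact (congrArg (· ≫ kernel.ι (ε A)) hg).trans (kernel.lift_ι _ _ _)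
    · rintro ⟨g, rfl⟩
      change (g ≫ ε (kernel (ε A)) ≫ kernel.ι (ε A)) ≫ ε A = 0
      simp
  exact ⟨{
    W := fun n => W (C n)
    mem := fun n => hW _
    d := fun n => d (C n)
    ε := ε M
    d_comp_d := fun n => by
      change (_ ≫ kernel.ι (ε (kernel (ε (C n))))) ≫ ε (kernel (ε (C n))) ≫ kernel.ι (ε (C n)) = 0
      simp
    d_comp_ε := by
      change (_ ≫ kernel.ι (ε M)) ≫ ε M = 0
      simp
    surjective := fun V hV => hε M V hV
    exact_zero := fun V hV => key M V hV
    exact_succ := fun V hV n f => by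
      constructor
      · intro hf
        refine (key (kernel (ε (C n))) V hV f).1 ?_
        have hf' : f ≫ ε (kernel (ε (C n))) ≫ kernel.ι (ε (C n)) = 0 := hf
        rw [← Category.assoc] at hf'
        exact zero_of_comp_mono _ hf'
      · rintro ⟨g, rfl⟩
        change (g ≫ _ ≫ kernel.ι (ε (kernel (ε (C n))))) ≫
          ε (kernel (ε (C n))) ≫ kernel.ι (ε (C n)) = 0
        simp }⟩

end ExistsResolution

/-! ### Directed unions of pure submodules. -/

section PureSubmodule

variable {S : Type u} [Ring S] {V : Type u} [AddCommGroup V] [Module S V]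

theorem pureMap_subtype_iff (U : Submodule S V) :
    PureMap U.subtype ↔ ∀ (m n : ℕ) (s : Fin m → Fin n → S) (a : Fin m → V), (∀ i, a i ∈ U) →
      (∃ y : Fin n → V, ∀ i, ∑ j, s i j • y j = a i) →
        ∃ y : Fin n → V, (∀ j, y j ∈ U) ∧ ∀ i, ∑ j, s i j • y j = a i := by
  constructor
  · intro h m n s a ha hy
    obtain ⟨y, hy⟩ := h m n s (fun i => ⟨a i, ha i⟩) hy
    exact ⟨fun j => y j, fun j => (y j).2, fun i => by simpa using congrArg Subtype.val (hy i)⟩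
  · intro h m n s a hy
    obtain ⟨y, hyU, hy⟩ := h m n s (fun i => a i) (fun i => (a i).2) hy
    exact ⟨fun j => ⟨y j, hyU j⟩, fun i => Subtype.ext (by simpa using hy i)⟩

theorem pureMap_sSup_subtype {c : Set (Submodule S V)} (hne : c.Nonempty)
    (hc : DirectedOn (· ≤ ·) c) (h : ∀ U ∈ c, PureMap U.subtype) : PureMap (sSup c).subtype := by
  rw [pureMap_subtype_iff]
  intro m n s a ha hy
  have hmem : ∀ i, ∃ U ∈ c, a i ∈ U := fun i =>
    (Submodule.mem_sSup_of_directed hne hc).1 (ha i)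
  choose U hUc hU using hmem
  have : ∃ D ∈ c, ∀ i ∈ (Finset.univ : Finset (Fin m)), U i ≤ D := by
    induction (Finset.univ : Finset (Fin m)) using Finset.induction_on with
    | empty => exact ⟨_, hne.some_mem, by simp⟩
    | insert i t _ ih =>
      obtain ⟨D, hD, hle⟩ := ih
      obtain ⟨E, hE, h₁, h₂⟩ := hc D hD (U i) (hUc i)
      refine ⟨E, hE, fun k hk => ?_⟩
      rcases Finset.mem_insert.1 hk with rfl | hk
      · exact h₂
      · exact (hle k hk).trans h₁
  obtain ⟨D, hD, hle⟩ := this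
  obtain ⟨y, hyD, hy⟩ := (pureMap_subtype_iff D).1 (h D hD) m n s a
    (fun i => hle i (Finset.mem_univ i) (hU i)) hy
  exact ⟨y, fun j => le_sSup hD (hyD j), hy⟩

end PureSubmodule

/-! ### Lifting from weak flat modules by small pure steps. -/

section ExtendLift

open Cardinal

variable {S : Type u} [Ring S]

/-- A homomorphism is left orthogonal to the inclusions of submodules of the free module on `X`
with quotient in `𝒞`. -/
def LiftsAgainst (𝒞 : ObjectProperty (ModuleCat.{u} S)) (X : Type u) {W N : Type u}
    [AddCommGroup W] [Module S W] [AddCommGroup N] [Module S N] (p : W →ₗ[S] N) : Prop :=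
  ∀ K : Submodule S (X →₀ S), 𝒞 (ModuleCat.of S ((X →₀ S) ⧸ K)) →
    ∀ (α : K →ₗ[S] W) (β : (X →₀ S) →ₗ[S] N), p ∘ₗ α = β ∘ₗ K.subtype →
      ∃ γ : (X →₀ S) →ₗ[S] W, γ ∘ₗ K.subtype = α ∧ p ∘ₗ γ = β

variable {𝒞 : ObjectProperty (ModuleCat.{u} S)} {X V W N : Type u}
  [AddCommGroup V] [Module S V] [AddCommGroup W] [Module S W] [AddCommGroup N] [Module S N]

/-- A lift defined on a proper pure submodule extends to a larger pure submodule. -/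
theorem exists_larger_lift
    (hpure : ∀ {A B : ModuleCat.{u} S} {f : A →ₗ[S] B}, PureMap f → 𝒞 B → 𝒞 A)
    (hquot : ∀ {A B C : ModuleCat.{u} S} {f : A →ₗ[S] B} {g : B →ₗ[S] C}, PureMap f →
      Function.Exact f g → Function.Surjective g → 𝒞 B → 𝒞 C)
    (hX : ℵ₀ ≤ #X) (hSX : #S ≤ #X) (hV : 𝒞 (ModuleCat.of S V)) {p : W →ₗ[S] N}
    (hp : LiftsAgainst 𝒞 X p) (f : V →ₗ[S] N) (h : V →ₗ.[S] W)
    (hD : PureMap h.domain.subtype)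
    (hpf : ∀ x : h.domain, p (h x) = f x) (x : V) :
    ∃ h' : V →ₗ.[S] W, h ≤ h' ∧ x ∈ h'.domain ∧ PureMap h'.domain.subtype ∧
      ∀ x : h'.domain, p (h' x) = f x := by
  let D := h.domain
  -- `U` is pure in the pure quotient V/D, so it lies in `𝒞`, and its size makes it a quotient of
  -- the free module on `X`. The new domain will be its preimage in V.
  obtain ⟨U, hxU, hcard, hU⟩ := exists_small_pure_submodule S (V ⧸ D) {D.mkQ x} hX hSX
    (by rw [mk_singleton]; exact one_le_aleph0.trans hX)
  obtain ⟨r, hr⟩ := exists_surjective_of_mk_le (S := S) X U hcard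
  have hVD : 𝒞 (ModuleCat.of S (V ⧸ D)) :=
    hquot (A := ModuleCat.of S D) (B := ModuleCat.of S V) (C := ModuleCat.of S (V ⧸ D)) hD
      (g := D.mkQ) (by rw [LinearMap.exact_iff]; simp [D]) D.mkQ_surjective hV
  have hK : 𝒞 (ModuleCat.of S ((X →₀ S) ⧸ LinearMap.ker r)) :=
    hpure (B := ModuleCat.of S (V ⧸ D))
      (hU.comp (pureMap_linearEquiv (r.quotKerEquivOfSurjective hr))) hVD
  obtain ⟨q, hq⟩ := Module.projective_lifting_property D.mkQ (U.subtype ∘ₗ r) D.mkQ_surjective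
  have hq' : ∀ z, D.mkQ (q z) = r z := fun z => DFunLike.congr_fun hq z
  have hDq : ∀ y, y ∈ D ↔ D.mkQ y = 0 := fun y => (Submodule.Quotient.mk_eq_zero D).symm
  have hqD : ∀ z : LinearMap.ker r, q z ∈ D := fun z => by
    rw [hDq, hq', z.2]
    rfl
  -- On ker r the map `q` lands in D, where `h` prescribes the lift. The lifting property extends
  -- this to the whole free module, and `h` and `γ` then glue along D × F → V.
  obtain ⟨γ, hγ, hpγ⟩ := hp (LinearMap.ker r) hK
    (h.toFun ∘ₗ (q ∘ₗ (LinearMap.ker r).subtype).codRestrict D hqD) (f ∘ₗ q) (by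
      ext z
      exact hpf _)
  let Φ : D × (X →₀ S) →ₗ[S] V := D.subtype.coprod q
  let Ψ : D × (X →₀ S) →ₗ[S] W := h.toFun.coprod γ
  have hker : LinearMap.ker Φ ≤ LinearMap.ker Ψ := by
    rintro ⟨d, z⟩ hdz
    have h0 : (d : V) + q z = 0 := hdz
    have hz : z ∈ LinearMap.ker r := by
      have hqz : q z ∈ D := by
        rw [eq_neg_of_add_eq_zero_right h0]
        exact D.neg_mem d.2
      rw [LinearMap.mem_ker]
      apply Subtype.ext
      rw [← hq', (hDq _).1 hqz]
      rfl
    have h1 : γ z = h.toFun ⟨q z, hqD ⟨z, hz⟩⟩ := DFunLike.congr_fun hγ ⟨z, hz⟩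
    change h.toFun d + γ z = 0
    rw [h1, ← map_add, ← map_zero h.toFun]
    exact congrArg _ (Subtype.ext h0)
  let h' : V →ₗ.[S] W := ⟨LinearMap.range Φ,
    (LinearMap.ker Φ).liftQ Ψ hker ∘ₗ Φ.quotKerEquivRange.symm.toLinearMap⟩
  have hh' : ∀ (w : D × (X →₀ S)) (y : h'.domain), Φ w = y → h' y = Ψ w := by
    rintro w ⟨y, hy⟩ (rfl : Φ w = y)
    change (LinearMap.ker Φ).liftQ Ψ hker (Φ.quotKerEquivRange.symm ⟨Φ w, hy⟩) = Ψ w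
    have : Φ.quotKerEquivRange.symm ⟨Φ w, hy⟩ = (LinearMap.ker Φ).mkQ w := by
      rw [LinearEquiv.symm_apply_eq]; rfl
    rw [this]
    rfl
  have hmem : ∀ y, y ∈ LinearMap.range Φ ↔ D.mkQ y ∈ U := by
    intro y
    constructor
    · rintro ⟨⟨d, z⟩, rfl⟩
      have : D.mkQ (Φ (d, z)) = r z := by
        change D.mkQ (d + q z) = _
        rw [map_add, hq', (hDq _).1 d.2, zero_add]
      rw [this]
      exact (r z).2
    · intro hy
      obtain ⟨z, hz⟩ := hr ⟨_, hy⟩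
      have : y - q z ∈ D := by
        rw [hDq, map_sub, hq', hz, sub_self]
      exact ⟨(⟨_, this⟩, z), by simp [Φ]⟩
  refine ⟨h', ⟨fun d hd => ⟨(⟨d, hd⟩, 0), by simp [Φ]⟩, ?_⟩,
    (hmem x).2 (hxU rfl), ?_, ?_⟩
  · intro d d' hdd'
    rw [hh' (d, 0) d' (by simpa [Φ] using hdd')]
    change _ = h.toFun d + γ 0
    rw [map_zero, add_zero]
    rfl
  · change PureMap (LinearMap.range Φ).subtype
    rw [pureMap_subtype_iff] at hU hD ⊢
    rintro m n s a ha ⟨y, hy⟩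
    -- Solve the system modulo D inside `U`, lift the solution to V, and absorb the remaining error
    -- by a solution in the pure submodule D.
    obtain ⟨v, hvU, hv⟩ := hU m n s (fun i => D.mkQ (a i)) (fun i => (hmem _).1 (ha i))
      ⟨fun j => D.mkQ (y j), fun i => by rw [← hy i, map_sum]; simp only [map_smul]⟩
    choose t ht using fun j => D.mkQ_surjective (v j)
    obtain ⟨d, hdD, hd⟩ := hD m n s (fun i => a i - ∑ j, s i j • t j) (fun i => by
        change _ ∈ D
        rw [hDq, map_sub, map_sum, ← hv i, sub_eq_zero]
        simp only [map_smul, ht])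
      ⟨fun j => y j - t j, fun i => by simp only [smul_sub, Finset.sum_sub_distrib, hy]⟩
    refine ⟨fun j => d j + t j, fun j => ?_, fun i => ?_⟩
    · rw [hmem, map_add, ht, (hDq _).1 (hdD j), zero_add]
      exact hvU j
    · simp only [smul_add, Finset.sum_add_distrib, hd, sub_add_cancel]
  · rintro ⟨_, ⟨⟨d, z⟩, rfl⟩⟩
    rw [hh' (d, z) _ rfl]
    change p (h.toFun d + γ z) = f (d + q z)
    rw [map_add, map_add]
    exact congrArg₂ _ (hpf d) (DFunLike.congr_fun hpγ z)

/-- Homomorphisms from modules in `𝒞` lift along `p`. -/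
theorem LiftsAgainst.exists_lift
    (hpure : ∀ {A B : ModuleCat.{u} S} {f : A →ₗ[S] B}, PureMap f → 𝒞 B → 𝒞 A)
    (hquot : ∀ {A B C : ModuleCat.{u} S} {f : A →ₗ[S] B} {g : B →ₗ[S] C}, PureMap f →
      Function.Exact f g → Function.Surjective g → 𝒞 B → 𝒞 C)
    (hX : ℵ₀ ≤ #X) (hSX : #S ≤ #X) (hV : 𝒞 (ModuleCat.of S V)) {p : W →ₗ[S] N}
    (hp : LiftsAgainst 𝒞 X p) (f : V →ₗ[S] N) : ∃ g : V →ₗ[S] W, p ∘ₗ g = f := by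
  -- Purity of the domain is part of the Zorn condition because extending a partial lift needs V/D
  -- to stay in `𝒞`.
  let T : Set (V →ₗ.[S] W) := {h | PureMap h.domain.subtype ∧ ∀ x : h.domain, p (h x) = f x}
  have h0 : (⊥ : V →ₗ.[S] W) ∈ T := by
    refine ⟨(pureMap_subtype_iff _).2 fun m _ s a ha _ =>
      ⟨0, fun _ => Submodule.zero_mem _, fun i => ?_⟩, ?_⟩
    · have : a i = 0 := ha i
      simp [this]
    · rintro ⟨x, (hx : x = 0)⟩
      have : x = 0 := hx
      subst this
      have h1 : (⟨0, hx⟩ : (⊥ : V →ₗ.[S] W).domain) = 0 := rfl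
      rw [h1, LinearPMap.map_zero, map_zero]
      exact (map_zero f).symm
  obtain ⟨h, -, hT, hmax⟩ := zorn_le_nonempty₀ T (fun c hcT hc y hy => by
    have hdir : DirectedOn (· ≤ ·) c := hc.directedOn
    refine ⟨LinearPMap.sSup c hdir, ⟨?_, ?_⟩, fun z hz => LinearPMap.le_sSup hdir hz⟩
    · change PureMap (sSup (LinearPMap.domain '' c)).subtype
      refine pureMap_sSup_subtype (Set.Nonempty.image _ ⟨y, hy⟩) ?_ ?_
      · rintro _ ⟨a, ha, rfl⟩ _ ⟨b, hb, rfl⟩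
        obtain ⟨e, he, h₁, h₂⟩ := hdir a ha b hb
        exact ⟨_, ⟨e, he, rfl⟩, h₁.1, h₂.1⟩
      · rintro _ ⟨a, ha, rfl⟩
        exact (hcT ha).1
    · rintro ⟨x, hx⟩
      obtain ⟨k, hk, hxk⟩ := (LinearPMap.mem_domain_sSup_iff ⟨y, hy⟩ hdir).1 hx
      have := LinearPMap.sSup_apply hdir hk ⟨x, hxk⟩
      exact (congrArg p this).trans ((hcT hk).2 ⟨x, hxk⟩)) ⊥ h0
  have htop : ∀ x, x ∈ h.domain := by
    intro x
    by_contra hx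
    obtain ⟨h', hle, hx', hT'⟩ :=
      exists_larger_lift hpure hquot hX hSX hV hp f h hT.1 hT.2 x
    exact hx ((hmax hT' hle).1 hx')
  refine ⟨h.toFun ∘ₗ LinearMap.id.codRestrict h.domain htop, ?_⟩
  ext x
  exact hT.2 ⟨x, htop x⟩

end ExtendLift

/-! ### The small object argument for inclusions into a free module. -/

section SmallObject

open MorphismProperty Limits in
/-- In a Grothendieck abelian category, a small family of monomorphisms whose sources are subobjects
of a fixed object permits the small object argument. -/
theorem hasSmallObjectArgument_of_le_monomorphisms {D : Type*} [Category* D] [Abelian D]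
    [IsGrothendieckAbelian.{u} D] (I : MorphismProperty D) [IsSmall.{u} I]
    (hI : I ≤ monomorphisms D) (G : D)
    (hG : ∀ {A B : D} (i : A ⟶ B), I i → ∃ m : A ⟶ G, Mono m) :
    HasSmallObjectArgument.{u} I := by
  obtain ⟨κ, hκ', hκ⟩ := HasCardinalLT.exists_regular_cardinal.{u} (Subobject G)
  have : Fact κ.IsRegular := ⟨hκ'⟩
  have : Nonempty κ.ord.ToType := by simpa using hκ'.ne_zero
  have := WellFoundedLT.toOrderBot κ.ord.ToType
  exact ⟨κ, inferInstance, inferInstance,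
    { preservesColimit {A B X Y} i hi f hf := by
        -- Monomorphisms are stable under coproducts and pushouts here, so the cell attachments form
        -- a chain of monomorphisms. A source with fewer than κ subobjects is small for such chains.
        let hf' : (monomorphisms D).TransfiniteCompositionOfShape κ.ord.ToType f :=
          { toTransfiniteCompositionOfShape := hf.toTransfiniteCompositionOfShape
            map_mem j hj := by
              have := (hf.attachCells j hj).pushouts_coproducts
              simp only [ofHoms_homFamily] at this
              refine (?_ : _ ≤ monomorphisms D) _ this
              simp only [pushouts_le_iff, coproducts_le_iff]
              exact hI }
        have (j j' : κ.ord.ToType) (φ : j ⟶ j') : Mono (hf'.F.map φ) := hf'.mem_map φ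
        apply IsGrothendieckAbelian.preservesColimit_coyoneda_obj_of_mono (Y := hf'.F) (κ := κ)
        obtain ⟨m, hm⟩ := hG i hi
        exact Subobject.hasCardinalLT_of_mono hκ m }⟩

variable {S : Type u} [Ring S]

/-- The inclusions of the submodules of `F` with quotient in `𝒞`. -/
def subobjectInclusions (𝒞 : ObjectProperty (ModuleCat.{u} S)) (F : Type u) [AddCommGroup F]
    [Module S F] : MorphismProperty (ModuleCat.{u} S) :=
  .ofHoms fun K : {K : Submodule S F // 𝒞 (ModuleCat.of S (F ⧸ K))} =>
    ModuleCat.ofHom K.1.subtype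

theorem mem_subobjectInclusions {𝒞 : ObjectProperty (ModuleCat.{u} S)} {F : Type u}
    [AddCommGroup F] [Module S F] (K : Submodule S F) (hK : 𝒞 (ModuleCat.of S (F ⧸ K))) :
    subobjectInclusions 𝒞 F (ModuleCat.ofHom K.subtype) :=
  MorphismProperty.ofHoms.mk (⟨K, hK⟩ : {K : Submodule S F // 𝒞 (ModuleCat.of S (F ⧸ K))})

theorem subobjectInclusions_le_monomorphisms (𝒞 : ObjectProperty (ModuleCat.{u} S)) (F : Type u)
    [AddCommGroup F] [Module S F] :
    subobjectInclusions 𝒞 F ≤ MorphismProperty.monomorphisms _ := by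
  rintro _ _ _ ⟨K⟩
  exact (ModuleCat.mono_iff_injective _).2 K.1.injective_subtype

instance (𝒞 : ObjectProperty (ModuleCat.{u} S)) (F : Type u) [AddCommGroup F]
    [Module S F] : MorphismProperty.HasSmallObjectArgument.{u} (subobjectInclusions 𝒞 F) := by
  have : MorphismProperty.IsSmall.{u} (subobjectInclusions 𝒞 F) := by
    unfold subobjectInclusions
    infer_instance
  refine hasSmallObjectArgument_of_le_monomorphisms _
    (subobjectInclusions_le_monomorphisms 𝒞 F) (ModuleCat.of S F) ?_
  rintro _ _ _ ⟨K⟩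
  exact ⟨ModuleCat.ofHom K.1.subtype, (ModuleCat.mono_iff_injective _).2 K.1.injective_subtype⟩

theorem liftsAgainst_iff_rlp (𝒞 : ObjectProperty (ModuleCat.{u} S)) (X : Type u)
    {W N : ModuleCat.{u} S} (p : W ⟶ N) :
    LiftsAgainst 𝒞 X p.hom ↔ (subobjectInclusions 𝒞 (X →₀ S)).rlp p := by
  constructor
  · rintro h _ _ _ ⟨K⟩
    refine ⟨fun {α β} sq => ?_⟩
    obtain ⟨γ, h₁, h₂⟩ := h K.1 K.2 α.hom β.hom (congrArg ModuleCat.Hom.hom sq.w)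
    exact ⟨⟨⟨ModuleCat.ofHom γ, ModuleCat.hom_ext h₁, ModuleCat.hom_ext h₂⟩⟩⟩
  · intro h K hK α β hαβ
    have := h _ (mem_subobjectInclusions K hK)
    let α' : ModuleCat.of S K ⟶ W := ModuleCat.ofHom α
    let β' : ModuleCat.of S (X →₀ S) ⟶ N := ModuleCat.ofHom β
    have sq : CommSq α' (ModuleCat.ofHom K.subtype) p β' :=
      ⟨ModuleCat.hom_ext hαβ⟩
    exact ⟨sq.lift.hom, congrArg ModuleCat.Hom.hom sq.fac_left,
      congrArg ModuleCat.Hom.hom sq.fac_right⟩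

/-- Every module is the target of a homomorphism lifting against the inclusions, whose source lifts
against all homomorphisms with this property. -/
theorem exists_liftsAgainst (𝒞 : ObjectProperty (ModuleCat.{u} S)) (X : Type u)
    (N : ModuleCat.{u} S) : ∃ (W : ModuleCat.{u} S) (p : W ⟶ N), LiftsAgainst 𝒞 X p.hom ∧
      ∀ {A B : ModuleCat.{u} S} (q : A ⟶ B), LiftsAgainst 𝒞 X q.hom →
        ∀ b : W ⟶ B, ∃ a : W ⟶ A, a ≫ q = b := by
  let I := subobjectInclusions 𝒞 (X →₀ S)
  -- Factoring 0 → N makes the middle object lift through every map with the right lifting property,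
  -- since a square out of 0 → W is just a map from W.
  let d := (MorphismProperty.functorialFactorizationData I.rlp.llp I.rlp).factorizationData
    (0 : ModuleCat.of S PUnit.{u + 1} ⟶ N)
  refine ⟨d.Z, d.p, (liftsAgainst_iff_rlp 𝒞 X _).2 d.hp, fun {A B} q hq b => ?_⟩
  have := d.hi q ((liftsAgainst_iff_rlp 𝒞 X q).1 hq)
  have sq : CommSq (0 : ModuleCat.of S PUnit.{u + 1} ⟶ A) d.i q b := by
    refine ⟨ModuleCat.hom_ext (LinearMap.ext fun x => ?_)⟩
    have hx : x = 0 := rfl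
    rw [hx, map_zero, map_zero]
  exact ⟨sq.lift, sq.fac_right⟩

end SmallObject

/-! ### Weak flat precovers. -/

section Precover

variable {R : Type u} [Ring R]

/-- Restriction of characters. -/
def restrictChar {L L' : Type u} [AddCommGroup L] [Module R L] [AddCommGroup L'] [Module R L']
    (g : L →ₗ[R] L') : CharRight L' →ₗ[Rᵐᵒᵖ] CharRight L where
  toFun χ := χ.comp g.toAddMonoidHom
  map_add' _ _ := rfl
  map_smul' r χ := DFunLike.ext _ _ fun l => congrArg χ (map_smul g (unop r) l).symm

theorem uncurryRight_restrictChar {M L L' : Type u} [AddCommGroup M] [Module Rᵐᵒᵖ M]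
    [AddCommGroup L] [Module R L] [AddCommGroup L'] [Module R L']
    (g : L →ₗ[R] L') (ψ : M →ₗ[Rᵐᵒᵖ] CharRight L') (x : RingTensor R M L) :
    uncurryRight (restrictChar g ∘ₗ ψ) x =
      uncurryRight ψ (RingTensor.map R LinearMap.id g x) := by
  have : uncurryRight (restrictChar g ∘ₗ ψ) =
      (uncurryRight ψ).comp (RingTensor.map R LinearMap.id g) :=
    RingTensor.hom_ext R fun _ _ => rfl
  exact DFunLike.congr_fun this x

/-- A lift through P₀⁺ → K⁺ turns a character of W ⊗ K into the restriction of one of W ⊗ P₀, so no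
nonzero element can die there. -/
theorem weakFlat_of_lifts {W : ModuleCat.{u} Rᵐᵒᵖ}
    (h : ∀ (N : ModuleCat.{u} R) (P : ProjectiveResolution N),
      (∀ n, Module.Finite R (P.complex.X n)) → ∀ β : W →ₗ[Rᵐᵒᵖ] CharRight (Syzygy P),
        ∃ γ : W →ₗ[Rᵐᵒᵖ] CharRight (P.complex.X 0), restrictChar (syzygyEmb P) ∘ₗ γ = β) :
    weakFlat R W := by
  rw [weakFlat_iff_injective]
  intro N P hP
  rw [injective_iff_map_eq_zero]
  intro x hx
  by_contra hne
  obtain ⟨χ, hχ⟩ := exists_character_ne_zero hne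
  obtain ⟨γ, hγ⟩ := h N P hP (curryRight χ)
  apply hχ
  rw [← uncurryRight_curryRight χ, ← hγ, uncurryRight_restrictChar, hx, map_zero]

section Lift

variable {A F Q L P : Type u} [AddCommGroup A] [Module Rᵐᵒᵖ A] [AddCommGroup F] [Module Rᵐᵒᵖ F]
  [AddCommGroup Q] [Module Rᵐᵒᵖ Q] [AddCommGroup L] [Module R L] [AddCommGroup P] [Module R P]
  {i : A →ₗ[Rᵐᵒᵖ] F} {π : F →ₗ[Rᵐᵒᵖ] Q} {e : L →ₗ[R] P}

/-- Since Q ⊗ L → Q ⊗ P is injective, `v` dies in Q ⊗ L and so comes from A ⊗ L. Injectivity of A ⊗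
P → F ⊗ P, valid for P finitely generated projective, identifies the image with `u`. -/
theorem exists_map_eq_of_map_eq [Module.Finite R P] [Module.Projective R P]
    (hi : Function.Injective i) (hex : Function.Exact i π) (hπ : Function.Surjective π)
    (he : Function.Injective (RingTensor.map R (LinearMap.id : Q →ₗ[Rᵐᵒᵖ] Q) e))
    (u : RingTensor R A P) (v : RingTensor R F L)
    (huv : RingTensor.map R LinearMap.id e v = RingTensor.map R i LinearMap.id u) :
    ∃ w : RingTensor R A L, RingTensor.map R LinearMap.id e w = u := by
  obtain ⟨n, p, φ, hφ⟩ := exists_dualBasis R P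
  have hv : RingTensor.map R π LinearMap.id v = 0 := by
    refine he ?_
    rw [map_zero, RingTensor.map_swap, huv]
    exact (RingTensor.exact_map_left P hex hπ _).2 ⟨u, rfl⟩
  obtain ⟨w, rfl⟩ := (RingTensor.exact_map_left L hex hπ v).1 hv
  refine ⟨w, RingTensor.map_injective_of_dualBasis hφ hi ?_⟩
  rw [← RingTensor.map_swap, huv]

/-- A homomorphism `A → P⁺` with zero restriction to `L` extends to `F`. -/
theorem exists_extension_restrictChar [Module.Finite R P] [Module.Projective R P]
    (hi : Function.Injective i) (hex : Function.Exact i π) (hπ : Function.Surjective π)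
    (he : Function.Injective (RingTensor.map R (LinearMap.id : Q →ₗ[Rᵐᵒᵖ] Q) e))
    (δ : A →ₗ[Rᵐᵒᵖ] CharRight P) (hδ : restrictChar e ∘ₗ δ = 0) :
    ∃ δ' : F →ₗ[Rᵐᵒᵖ] CharRight P, δ' ∘ₗ i = δ ∧ restrictChar e ∘ₗ δ' = 0 := by
  -- Extending the character from A ⊗ P to (F ⊗ P)/H, rather than to F ⊗ P, keeps the restriction to
  -- L zero.
  let H := (RingTensor.map R (LinearMap.id : F →ₗ[Rᵐᵒᵖ] F) e).range
  obtain ⟨χ, hχ⟩ := exists_character_extension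
    ((QuotientAddGroup.mk' H).comp (RingTensor.map R i (LinearMap.id : P →ₗ[R] P)))
    (uncurryRight δ) (by
      intro u hu
      obtain ⟨v, hv⟩ := (QuotientAddGroup.eq_zero_iff _).1 hu
      obtain ⟨w, rfl⟩ := exists_map_eq_of_map_eq hi hex hπ he u v hv
      rw [← uncurryRight_restrictChar, hδ]
      have h0 : uncurryRight (0 : A →ₗ[Rᵐᵒᵖ] CharRight L) = 0 :=
        RingTensor.hom_ext R fun _ _ => rfl
      rw [h0]
      rfl)
  refine ⟨curryRight (χ.comp (QuotientAddGroup.mk' H)),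
    LinearMap.ext fun k => DFunLike.ext _ _ fun x => hχ (RingTensor.tmul R k x),
    LinearMap.ext fun k => DFunLike.ext _ _ fun x => ?_⟩
  have : QuotientAddGroup.mk' H (RingTensor.tmul R k (e x)) = 0 :=
    (QuotientAddGroup.eq_zero_iff _).2 ⟨RingTensor.tmul R k x, rfl⟩
  exact (congrArg χ this).trans (map_zero χ)

/-- Projectivity of F lifts β to some γ₀; the error α - γ₀ ∘ i restricts to zero on L, so it extends
to F and corrects γ₀. -/
theorem exists_lift_restrictChar [Module.Projective Rᵐᵒᵖ F] [Module.Finite R P]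
    [Module.Projective R P] (hi : Function.Injective i) (hex : Function.Exact i π)
    (hπ : Function.Surjective π) (heinj : Function.Injective e)
    (he : Function.Injective (RingTensor.map R (LinearMap.id : Q →ₗ[Rᵐᵒᵖ] Q) e))
    (α : A →ₗ[Rᵐᵒᵖ] CharRight P) (β : F →ₗ[Rᵐᵒᵖ] CharRight L)
    (hαβ : restrictChar e ∘ₗ α = β ∘ₗ i) :
    ∃ γ : F →ₗ[Rᵐᵒᵖ] CharRight P, γ ∘ₗ i = α ∧ restrictChar e ∘ₗ γ = β := by
  have hsurj : Function.Surjective (restrictChar e) := fun χ => by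
    obtain ⟨χ', h⟩ := exists_character_extension_of_injective e.toAddMonoidHom heinj χ
    exact ⟨χ', DFunLike.ext _ _ h⟩
  obtain ⟨γ₀, hγ₀⟩ := Module.projective_lifting_property _ β hsurj
  obtain ⟨δ, h₁, h₂⟩ := exists_extension_restrictChar hi hex hπ he (α - γ₀ ∘ₗ i) (by
    rw [LinearMap.comp_sub, hαβ, ← LinearMap.comp_assoc, hγ₀, sub_self])
  refine ⟨γ₀ + δ, ?_, ?_⟩
  · rw [LinearMap.add_comp, h₁, add_sub_cancel]
  · rw [LinearMap.comp_add, h₂, hγ₀, add_zero]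

end Lift

theorem liftsAgainst_restrictChar {N : ModuleCat.{u} R} (P : ProjectiveResolution N)
    (hP : ∀ n, Module.Finite R (P.complex.X n)) (X : Type u) :
    LiftsAgainst (weakFlat R) X (restrictChar (syzygyEmb P)) := by
  intro K hK α β hαβ
  exact exists_lift_restrictChar (A := K) (F := X →₀ Rᵐᵒᵖ)
    (Q := (X →₀ Rᵐᵒᵖ) ⧸ K) (i := K.subtype) (π := K.mkQ) K.injective_subtype
    (by rw [LinearMap.exact_iff]; simp) K.mkQ_surjective (syzygyEmb_injective P)
    ((weakFlat_iff_injective _).1 hK N P hP) α β hαβ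

/-- Every right module has a weak flat precover. -/
theorem exists_weakFlat_precover (N : ModuleCat.{u} Rᵐᵒᵖ) :
    ∃ (W : ModuleCat.{u} Rᵐᵒᵖ) (ε : W ⟶ N), weakFlat R W ∧
      ∀ V, weakFlat R V → Function.Surjective (Preadditive.rightComp V ε) := by
  let X : Type u := ULift.{u} ℕ ⊕ Rᵐᵒᵖ
  have hX : Cardinal.aleph0 ≤ Cardinal.mk X := by
    rw [Cardinal.aleph0_le_mk_iff]
    infer_instance
  have hSX : Cardinal.mk Rᵐᵒᵖ ≤ Cardinal.mk X := Cardinal.mk_le_of_injective Sum.inr_injective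
  -- The size of `X` depends on R only: weak flat sources of any size are lifted by transfinite
  -- extension, in steps bounded by #X.
  obtain ⟨W, p, hp, hW⟩ := exists_liftsAgainst (weakFlat R) X N
  refine ⟨W, p, weakFlat_of_lifts fun N P hP β => ?_, fun V hV f => ?_⟩
  · obtain ⟨γ, hγ⟩ := hW (ModuleCat.ofHom (restrictChar (syzygyEmb P)))
      (liftsAgainst_restrictChar P hP X) (ModuleCat.ofHom β)
    exact ⟨γ.hom, congrArg ModuleCat.Hom.hom hγ⟩
  · obtain ⟨g, hg⟩ := LiftsAgainst.exists_lift (V := V) weakFlat_of_pureMap weakFlat_of_pureQuotient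
      hX hSX hV hp f.hom
    exact ⟨ModuleCat.ofHom g, ModuleCat.hom_ext hg⟩

end Precover

/-! ### The canonical maps as factorization and injectivity conditions. -/

section CanonicalMaps

variable {S : Type u} [Ring S] {𝒞 : ObjectProperty (ModuleCat.{u} S)} {M : ModuleCat.{u} S}

theorem LeftResolution.θ_surjective_iff (P : LeftResolution 𝒞 M) (L : ModuleCat.{u} S) :
    Function.Surjective (P.θ L) ↔ ∀ f : L ⟶ M, ∃ g : L ⟶ P.W 0, g ≫ P.ε = f := by
  constructor
  · intro h f
    obtain ⟨x, hx⟩ := h f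
    obtain ⟨g, rfl⟩ := QuotientAddGroup.mk_surjective x
    exact ⟨g, hx⟩
  · intro h f
    obtain ⟨g, hg⟩ := h f
    exact ⟨QuotientAddGroup.mk g, hg⟩

theorem RightResolution.θ_surjective_iff (Q : RightResolution 𝒞 M) (N : ModuleCat.{u} S) :
    Function.Surjective (Q.θ N) ↔ ∀ f : M ⟶ N, ∃ g : Q.W 0 ⟶ N, Q.η ≫ g = f := by
  constructor
  · intro h f
    obtain ⟨x, hx⟩ := h f
    obtain ⟨g, rfl⟩ := QuotientAddGroup.mk_surjective x
    exact ⟨g, hx⟩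
  · intro h f
    obtain ⟨g, hg⟩ := h f
    exact ⟨QuotientAddGroup.mk g, hg⟩

variable {R : Type u} [Ring R] {M : ModuleCat.{u} Rᵐᵒᵖ} {L : ModuleCat.{u} R}

theorem ϑOfWeakFlat_injective_iff (Q : RightResolution (weakFlat R) M) (L : ModuleCat.{u} R) :
    Function.Injective (ϑOfWeakFlat Q L) ↔
      Function.Injective (RingTensor.map R Q.η.hom (LinearMap.id : L →ₗ[R] L)) :=
  ⟨fun h => Subtype.val_injective.comp h, fun h => Function.Injective.of_comp (f := Subtype.val) h⟩

theorem ϑOfWeakInjective_injective_iff (M : ModuleCat.{u} Rᵐᵒᵖ)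
    (J : RightResolution (weakInjective R) L) :
    Function.Injective (ϑOfWeakInjective M J) ↔
      Function.Injective (RingTensor.map R (LinearMap.id : M →ₗ[Rᵐᵒᵖ] M) J.η.hom) :=
  ⟨fun h => Subtype.val_injective.comp h, fun h => Function.Injective.of_comp (f := Subtype.val) h⟩

end CanonicalMaps

/-! ### The equivalences for each choice of resolved variable. -/

section Equivalences

variable {R : Type u} [Ring R] {M : ModuleCat.{u} Rᵐᵒᵖ}

theorem weakFlat_of_factors_pureProjective
    (h : ∀ L : ModuleCat.{u} Rᵐᵒᵖ, PureProjectiveRight L → ∀ f : L ⟶ M,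
      ∃ W : ModuleCat.{u} Rᵐᵒᵖ, weakFlat R W ∧ ∃ (a : L ⟶ W) (b : W ⟶ M), a ≫ b = f) :
    weakFlat R M :=
  weakFlat_of_factors M fun L _ f =>
    let ⟨W, hW, a, b, hab⟩ :=
      h L (pureProjectiveRight_of_finitePresentation L) (ModuleCat.ofHom f)
    ⟨W, hW, a.hom, b.hom, congrArg ModuleCat.Hom.hom hab⟩

/-- Applied to M → M⁺⁺: this map is pure, so the first factor M → W of any factorization is pure
too. -/
theorem weakFlat_of_factors_pureInjective
    (h : ∀ N : ModuleCat.{u} Rᵐᵒᵖ, PureInjectiveRight N → ∀ f : M ⟶ N,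
      ∃ W : ModuleCat.{u} Rᵐᵒᵖ, weakFlat R W ∧ ∃ (a : M ⟶ W) (b : W ⟶ N), a ≫ b = f) :
    weakFlat R M := by
  obtain ⟨W, hW, a, b, hab⟩ := h _ (pureInjective_charRight (R := R) (CharLeft M))
    (ModuleCat.ofHom (doubleCharacter R M))
  refine weakFlat_of_map_injective hW a.hom fun L _ => ?_
  have h₁ := doubleCharacter_pure (R := R) (M := M) L
  rw [injective_iff_map_eq_zero] at h₁ ⊢
  intro x hx
  refine h₁ x ?_
  have hab' : b.hom ∘ₗ a.hom = doubleCharacter R M := congrArg ModuleCat.Hom.hom hab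
  rw [← hab']
  have := RingTensor.map_comp_apply (R := R) a.hom b.hom (LinearMap.id : L →ₗ[R] L)
    LinearMap.id x
  rw [hx, map_zero] at this
  exact this.symm

theorem weakFlat_of_retract {W : ModuleCat.{u} Rᵐᵒᵖ} (hW : weakFlat R W) (a : M ⟶ W) (b : W ⟶ M)
    (hab : a ≫ b = 𝟙 M) : weakFlat R M :=
  weakFlat_of_factors_pureProjective fun L _ f =>
    ⟨W, hW, f ≫ a, b, by rw [Category.assoc, hab, Category.comp_id]⟩

theorem map_injective_of_retract {W : ModuleCat.{u} Rᵐᵒᵖ} (a : M ⟶ W) (b : W ⟶ M)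
    (hab : a ≫ b = 𝟙 M) (L : ModuleCat.{u} R) :
    Function.Injective (RingTensor.map R a.hom (LinearMap.id : L →ₗ[R] L)) := by
  have hab' : b.hom ∘ₗ a.hom = LinearMap.id := congrArg ModuleCat.Hom.hom hab
  refine Function.LeftInverse.injective
    (g := RingTensor.map R b.hom (LinearMap.id : L →ₗ[R] L)) fun x => ?_
  rw [RingTensor.map_comp_apply, hab']
  exact RingTensor.map_id_apply x

/-- A character of M ⊗ L is a map from L to the weak injective module M⁺, so it extends along η and
detects elements of the kernel. -/
theorem map_injective_of_weakInjective_envelope (hM : weakFlat R M) {L W : ModuleCat.{u} R}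
    (η : L ⟶ W)
    (hη : ∀ V, weakInjective R V → Function.Surjective (Preadditive.leftComp V η)) :
    Function.Injective (RingTensor.map R (LinearMap.id : M →ₗ[Rᵐᵒᵖ] M) η.hom) := by
  rw [injective_iff_map_eq_zero]
  intro x hx
  by_contra hne
  obtain ⟨χ, hχ⟩ := exists_character_ne_zero hne
  obtain ⟨g, hg⟩ := hη _ (weakInjective_charLeft hM) (ModuleCat.ofHom (curryLeft χ))
  have hg' : g.hom ∘ₗ η.hom = curryLeft χ := congrArg ModuleCat.Hom.hom hg
  apply hχ
  rw [← uncurryLeft_curryLeft χ, ← hg']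
  refine (uncurryLeft_comp (M := M) g.hom η.hom x).trans ?_
  rw [hx, map_zero]

theorem weakFlat_tfae_left (P : ∀ N : ModuleCat.{u} Rᵐᵒᵖ, LeftResolution (weakFlat R) N)
    (Q : RightResolution (weakFlat R) M) :
    List.TFAE [
      weakFlat R M,
      ∀ L : ModuleCat.{u} Rᵐᵒᵖ, Function.Surjective ((P M).θ L),
      ∀ L : ModuleCat.{u} Rᵐᵒᵖ, PureProjectiveRight L → Function.Surjective ((P M).θ L),
      ∀ N : ModuleCat.{u} Rᵐᵒᵖ, Function.Surjective ((P N).θ M),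
      ∀ N : ModuleCat.{u} Rᵐᵒᵖ, PureInjectiveRight N → Function.Surjective ((P N).θ M),
      Function.Surjective ((P M).θ M),
      ∀ L : ModuleCat.{u} R, Function.Injective (ϑOfWeakFlat Q L),
      ∀ L : ModuleCat.{u} R, PureProjectiveLeft L → Function.Injective (ϑOfWeakFlat Q L)] := by
  simp only [LeftResolution.θ_surjective_iff, ϑOfWeakFlat_injective_iff]
  tfae_have 1 → 2 := fun hM L f => by
    obtain ⟨s, hs⟩ := (P M).surjective M hM (𝟙 M)
    have hs' : s ≫ (P M).ε = 𝟙 M := hs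
    exact ⟨f ≫ s, by rw [Category.assoc, hs', Category.comp_id]⟩
  tfae_have 2 → 3 := fun h L _ => h L
  tfae_have 3 → 1 := fun h => weakFlat_of_factors_pureProjective fun L hL f =>
    let ⟨g, hg⟩ := h L hL f
    ⟨_, (P M).mem 0, g, _, hg⟩
  tfae_have 1 → 4 := fun hM N => (P N).surjective M hM
  tfae_have 4 → 5 := fun h N _ => h N
  tfae_have 5 → 1 := fun h => weakFlat_of_factors_pureInjective fun N hN f =>
    let ⟨g, hg⟩ := h N hN f
    ⟨_, (P N).mem 0, g, _, hg⟩
  tfae_have 4 → 6 := fun h => h M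
  tfae_have 6 → 1 := fun h =>
    let ⟨g, hg⟩ := h (𝟙 M)
    weakFlat_of_retract ((P M).mem 0) g _ hg
  tfae_have 1 → 7 := fun hM L =>
    let ⟨g, hg⟩ := Q.surjective M hM (𝟙 M)
    map_injective_of_retract Q.η g hg L
  tfae_have 7 → 8 := fun h L _ => h L
  tfae_have 8 → 1 := fun h => weakFlat_of_map_injective (Q.mem 0) Q.η.hom fun L _ =>
    h L (pureProjectiveLeft_of_finitePresentation L)
  tfae_finish

theorem weakFlat_tfae_right (Q : ∀ N : ModuleCat.{u} Rᵐᵒᵖ, RightResolution (weakFlat R) N)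
    (J : ∀ L : ModuleCat.{u} R, RightResolution (weakInjective R) L) :
    List.TFAE [
      weakFlat R M,
      ∀ L : ModuleCat.{u} Rᵐᵒᵖ, Function.Surjective ((Q L).θ M),
      ∀ L : ModuleCat.{u} Rᵐᵒᵖ, PureProjectiveRight L → Function.Surjective ((Q L).θ M),
      ∀ N : ModuleCat.{u} Rᵐᵒᵖ, Function.Surjective ((Q M).θ N),
      ∀ N : ModuleCat.{u} Rᵐᵒᵖ, PureInjectiveRight N → Function.Surjective ((Q M).θ N),
      Function.Surjective ((Q M).θ M),
      ∀ L : ModuleCat.{u} R, Function.Injective (ϑOfWeakInjective M (J L)),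
      ∀ L : ModuleCat.{u} R, PureProjectiveLeft L →
        Function.Injective (ϑOfWeakInjective M (J L))] := by
  simp only [RightResolution.θ_surjective_iff, ϑOfWeakInjective_injective_iff]
  tfae_have 1 → 2 := fun hM L => (Q L).surjective M hM
  tfae_have 2 → 3 := fun h L _ => h L
  tfae_have 3 → 1 := fun h => weakFlat_of_factors_pureProjective fun L hL f =>
    let ⟨g, hg⟩ := h L hL f
    ⟨_, (Q L).mem 0, _, g, hg⟩
  tfae_have 1 → 4 := fun hM N f => by
    obtain ⟨s, hs⟩ := (Q M).surjective M hM (𝟙 M)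
    have hs' : (Q M).η ≫ s = 𝟙 M := hs
    exact ⟨s ≫ f, by rw [← Category.assoc, hs', Category.id_comp]⟩
  tfae_have 4 → 5 := fun h N _ => h N
  tfae_have 5 → 1 := fun h => weakFlat_of_factors_pureInjective fun N hN f =>
    let ⟨g, hg⟩ := h N hN f
    ⟨_, (Q M).mem 0, _, g, hg⟩
  tfae_have 4 → 6 := fun h => h M
  tfae_have 6 → 1 := fun h =>
    let ⟨g, hg⟩ := h (𝟙 M)
    weakFlat_of_retract ((Q M).mem 0) _ g hg
  tfae_have 1 → 7 := fun hM L =>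
    map_injective_of_weakInjective_envelope hM (J L).η (J L).surjective
  tfae_have 7 → 8 := fun h L _ => h L
  tfae_have 8 → 1 := fun h => weakFlat_of_weakInjective_envelopes fun L _ =>
    ⟨_, (J L).mem 0, (J L).η.hom, h L (pureProjectiveLeft_of_finitePresentation L)⟩
  tfae_finish

end Equivalences

end WeakHomological

theorem mainTheorem10 {R : Type u} [Ring R] :
    -- Every module has the resolutions from which the derived functors are computed.
    ((∀ N : ModuleCat.{u} Rᵐᵒᵖ,
        Nonempty (WeakHomological.LeftResolution (WeakHomological.weakFlat R) N)) ∧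
      (∀ N : ModuleCat.{u} Rᵐᵒᵖ,
        Nonempty (WeakHomological.RightResolution (WeakHomological.weakFlat R) N)) ∧
      (∀ L : ModuleCat.{u} R,
        Nonempty (WeakHomological.RightResolution (WeakHomological.weakInjective R) L))) ∧
    -- For every choice of these resolutions the conditions are equivalent, whichever of the two
    -- variables is resolved.
    ∀ (P : ∀ N : ModuleCat.{u} Rᵐᵒᵖ,
        WeakHomological.LeftResolution (WeakHomological.weakFlat R) N)
      (Q : ∀ N : ModuleCat.{u} Rᵐᵒᵖ,
        WeakHomological.RightResolution (WeakHomological.weakFlat R) N)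
      (J : ∀ L : ModuleCat.{u} R,
        WeakHomological.RightResolution (WeakHomological.weakInjective R) L)
      (M : ModuleCat.{u} Rᵐᵒᵖ),
      -- `Ext₀(X, Y)` from a left resolution of `Y`, `Tor⁰(M, L)` from a right resolution of `M`.
      List.TFAE [
        WeakHomological.weakFlat R M,
        ∀ L : ModuleCat.{u} Rᵐᵒᵖ, Function.Surjective ((P M).θ L),
        ∀ L : ModuleCat.{u} Rᵐᵒᵖ, WeakHomological.PureProjectiveRight L →
          Function.Surjective ((P M).θ L),
        ∀ N : ModuleCat.{u} Rᵐᵒᵖ, Function.Surjective ((P N).θ M),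
        ∀ N : ModuleCat.{u} Rᵐᵒᵖ, WeakHomological.PureInjectiveRight N →
          Function.Surjective ((P N).θ M),
        Function.Surjective ((P M).θ M),
        ∀ L : ModuleCat.{u} R, Function.Injective (WeakHomological.ϑOfWeakFlat (Q M) L),
        ∀ L : ModuleCat.{u} R, WeakHomological.PureProjectiveLeft L →
          Function.Injective (WeakHomological.ϑOfWeakFlat (Q M) L)] ∧
      -- `Ext₀(X, Y)` from a right resolution of `X`, `Tor⁰(M, L)` from a right resolution of `L`.
      List.TFAE [
        WeakHomological.weakFlat R M,
        ∀ L : ModuleCat.{u} Rᵐᵒᵖ, Function.Surjective ((Q L).θ M),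
        ∀ L : ModuleCat.{u} Rᵐᵒᵖ, WeakHomological.PureProjectiveRight L →
          Function.Surjective ((Q L).θ M),
        ∀ N : ModuleCat.{u} Rᵐᵒᵖ, Function.Surjective ((Q M).θ N),
        ∀ N : ModuleCat.{u} Rᵐᵒᵖ, WeakHomological.PureInjectiveRight N →
          Function.Surjective ((Q M).θ N),
        Function.Surjective ((Q M).θ M),
        ∀ L : ModuleCat.{u} R, Function.Injective (WeakHomological.ϑOfWeakInjective M (J L)),
        ∀ L : ModuleCat.{u} R, WeakHomological.PureProjectiveLeft L →
          Function.Injective (WeakHomological.ϑOfWeakInjective M (J L))] := by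
  exact ⟨⟨WeakHomological.nonempty_leftResolution WeakHomological.exists_weakFlat_precover,
    WeakHomological.nonempty_rightResolution
      (WeakHomological.exists_preenvelope WeakHomological.weakFlat_of_pureMap
        WeakHomological.weakFlat_pi),
    WeakHomological.nonempty_rightResolution
      (WeakHomological.exists_preenvelope WeakHomological.weakInjective_of_pureMap
        WeakHomological.weakInjective_pi)⟩,
    fun P Q J M => ⟨WeakHomological.weakFlat_tfae_left P (Q M),
      WeakHomological.weakFlat_tfae_right Q J⟩⟩
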